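/- Let $\mathbb D=\{t\in\mathbb C:|t|<1\}$, let $\sigma$ be normalized arc length on $\partial\mathbb D$, and for $h\in L^1(\partial\mathbb D)$ let $P[h](t)=P[h(s)](t)=\int_{\partial\mathbb D}\frac{1-|t|^2}{|s-t|^2}\,h(s)\,d\sigma(s)$, $t\in\mathbb D$, be its Poisson integral. For $r\in[1,\infty]$, $H^r(\mathbb D,\mathbb C^n)$ is the Hardy space of holomorphic functions $F:\mathbb D\to\mathbb C^n$ of the form $F=P[F_b]$ with $F_b\in L^r(\partial\mathbb D,\mathbb C^n)$; we write $F(s)$ for the boundary value $F_b(s)$, $s\in\partial\mathbb D$. Write $z\cdot w=\sum_j z_jw_j$ for $z,w\in\mathbb C^n$, and let $|\cdot|$ be the Euclidean norm. Let $p\in(1,\infty]$ and $q=p/(p-1)\in[1,\infty)$ (so $q=1$ if $p=\infty$). Let $\phi:\partial\mathbb D\times\mathbb C^n\to\mathbb R\cup\{+\infty\}$ be Borel measurable such that for every $s\in\partial\mathbb D$ the function $\phi_s=\phi(s,\cdot)$ is convex on $\mathbb C^n$. Assume that $\phi$ satisfies the $p$-uniform growth conditions: there are constants $c,C,A>0$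 such that for all $s\in\partial\mathbb D$ and $w\in\mathbb C^n$, $$c|w|^p-A\le\phi_s(w)\le C|w|^p+A\quad\text{if }p<\infty,\qquad \chi(c|w|)-A\le\phi_s(w)\le\chi(C|w|)+A\quad\text{if }p=\infty,$$ where $\chi(x)=0$ for $x\le1$ and $\chi(x)=+\infty$ for $x>1$; when $p=\infty$ assume also that every $\phi_s$ is lower semicontinuous. For $f_0\in L^1(\partial\mathbb D,\mathbb C)$ and $f\in H^q(\mathbb D,\mathbb C^n)$ put $L_{f_0,f}(t,w)=\operatorname{Re}(f(t)\cdot w)-P[\operatorname{Re}f_0](t)$ for $(t,w)\in\mathbb D\times\mathbb C^n$, and write $L_{f_0,f}\preceq\phi$ if for almost every $s\in\partial\mathbb D$ and every $z\in\mathbb C^n$, $$\limsup_{(0,1)\times\mathbb C^n\ni(r,w)\to(1,z)}L_{f_0,f}(rs,w)\le\phi(s,z).$$ Define, for $(t,w)\in\mathbb D\times\mathbb C^n$, $$\tilde\phi(t,w)=\sup\{L_{f_0,f}(t,w):\ f_0\in L^1(\partial\mathbb D,\mathbb C),\ f\in H^q(\mathbb D,\mathbb C^n),\ L_{f_0,f}\preceq\phi\}\in(-\infty,+\infty].$$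 Then for every $(t_0,w_0)\in\mathbb D\times\mathbb C^n$ with $\tilde\phi(t_0,w_0)<\infty$ there exists $F\in H^p(\mathbb D,\mathbb C^n)$ with $F(t_0)=w_0$ such that $s\mapsto\phi(s,F(s))$ is finite almost everywhere and integrable on $\partial\mathbb D$, and $$\tilde\phi(t,F(t))=P[\phi(s,F(s))](t)\qquad\text{for all }t\in\mathbb D.$$ In particular, $t\mapsto\tilde\phi(t,F(t))$ is (finite and) harmonic in $\mathbb D$. -/

import Mathlib

open MeasureTheory Filter Topology Set Metric
open scoped ENNReal

noncomputable section

namespace DiscInterpolation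

/-- The unit circle carries its Borel σ-algebra. -/
instance : MeasurableSpace Circle := borel Circle

instance : BorelSpace Circle := ⟨rfl⟩

/-- The normalized arc length `dσ = dθ / 2π` on the unit circle. -/
def arcMeasure : Measure Circle :=
  ENNReal.ofReal (2 * Real.pi)⁻¹ •
    Measure.map Circle.exp (volume.restrict (Ioc 0 (2 * Real.pi)))

/-- The Poisson integral `P[h](t) = ∫ (1 - |t|²) / |s - t|² h(s) dσ(s)`. -/
def poisson {E : Type*} [NormedAddCommGroup E] [NormedSpace ℝ E] (h : Circle → E) (t : ℂ) : E :=
  ∫ s : Circle, ((1 - ‖t‖ ^ 2) / ‖(s : ℂ) - t‖ ^ 2) • h s ∂arcMeasure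

/-- The bilinear (not sesquilinear) pairing `z · w = ∑ zⱼ wⱼ` on `ℂⁿ`. -/
def bil {n : ℕ} (z w : EuclideanSpace ℂ (Fin n)) : ℂ := ∑ j, z j * w j

/-- `F` belongs to the Hardy space `H^r(𝔻, ℂⁿ)` and has boundary values `Fb`: the function `F` is
holomorphic on the open unit disc and is there the Poisson integral of `Fb ∈ L^r(∂𝔻, ℂⁿ)`. -/
structure IsHardy {n : ℕ} (r : ℝ≥0∞) (F : ℂ → EuclideanSpace ℂ (Fin n))
    (Fb : Circle → EuclideanSpace ℂ (Fin n)) : Prop where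
  holomorphic : DifferentiableOn ℂ F (ball 0 1)
  memLp : MemLp Fb r arcMeasure
  eq_poisson : ∀ t ∈ ball (0 : ℂ) 1, F t = poisson Fb t

/-- A function `ℂⁿ → ℝ ∪ {+∞}` is convex if it is finite on a convex set, and is a finite convex
function on that set. -/
structure IsConvexFun {n : ℕ} (u : EuclideanSpace ℂ (Fin n) → EReal) : Prop where
  ne_bot : ∀ z, u z ≠ ⊥
  convexOn : ConvexOn ℝ {z | u z < ⊤} (fun z => (u z).toReal)

/-- `χ(x) = 0` for `x ≤ 1` and `χ(x) = +∞` for `x > 1`. -/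
def chi (x : ℝ) : EReal := if x ≤ 1 then 0 else ⊤

/-- The `p`-uniform growth conditions. For `p = ∞`, lower semicontinuity of every `φ s` is part of
the condition. -/
def UniformGrowth {n : ℕ} (p : ℝ≥0∞) (φ : Circle → EuclideanSpace ℂ (Fin n) → EReal) : Prop :=
  (∃ c C A : ℝ, 0 < c ∧ 0 < C ∧ 0 < A ∧ ∀ s w,
    if p = ∞ then
      chi (c * ‖w‖) - (A : EReal) ≤ φ s w ∧ φ s w ≤ chi (C * ‖w‖) + (A : EReal)
    else
      ((c * ‖w‖ ^ p.toReal - A : ℝ) : EReal) ≤ φ s w ∧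
        φ s w ≤ ((C * ‖w‖ ^ p.toReal + A : ℝ) : EReal)) ∧
  (p = ∞ → ∀ s, LowerSemicontinuous (φ s))

/-- The boundary relation `ψ ≼ φ` for a function `ψ` on `𝔻 × ℂⁿ`: for almost every `s ∈ ∂𝔻` and
every `z ∈ ℂⁿ`, the upper limit of `ψ(r s, w)` as `(0,1) × ℂⁿ ∋ (r, w) → (1, z)` is at most
`φ(s, z)`. -/
def BoundaryLE {n : ℕ} (ψ : ℂ → EuclideanSpace ℂ (Fin n) → ℝ)
    (φ : Circle → EuclideanSpace ℂ (Fin n) → EReal) : Prop :=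
  ∀ᵐ s : Circle ∂arcMeasure, ∀ z,
    limsup (fun x : ℝ × EuclideanSpace ℂ (Fin n) => ((ψ ((x.1 : ℂ) * (s : ℂ)) x.2 : ℝ) : EReal))
      (𝓝[Ioo (0 : ℝ) 1 ×ˢ univ] ((1 : ℝ), z)) ≤ φ s z

/-- `L_{f₀,f}(t,w) = Re (f(t) · w) - P[Re f₀](t)`. -/
def fiberLinear {n : ℕ} (f₀ : Circle → ℂ) (f : ℂ → EuclideanSpace ℂ (Fin n)) (t : ℂ)
    (w : EuclideanSpace ℂ (Fin n)) : ℝ :=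
  (bil (f t) w).re - poisson (fun s => (f₀ s).re) t

/-- The hull `φ̃(t,w)`: the supremum of `L_{f₀,f}(t,w)` over all `f₀ ∈ L¹(∂𝔻, ℂ)` and
`f ∈ H^q(𝔻, ℂⁿ)`, `1/p + 1/q = 1`, with `L_{f₀,f} ≼ φ`. -/
def hull {n : ℕ} (p : ℝ≥0∞) (φ : Circle → EuclideanSpace ℂ (Fin n) → EReal) (t : ℂ)
    (w : EuclideanSpace ℂ (Fin n)) : EReal :=
  sSup {x : EReal | ∃ (f₀ : Circle → ℂ) (f : ℂ → EuclideanSpace ℂ (Fin n))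
    (fb : Circle → EuclideanSpace ℂ (Fin n)),
      Integrable f₀ arcMeasure ∧ IsHardy (ENNReal.conjExponent p) f fb ∧
        BoundaryLE (fiberLinear f₀ f) φ ∧ x = ((fiberLinear f₀ f t w : ℝ) : EReal)}

end DiscInterpolation

end

/-!
Let `ω` be harmonic measure at `t₀`. Pairing with the conjugate of `φ` turns the definition of the
hull into the inequality `Re (G t₀ · w₀) ≤ ∫ φ* (G) dω + φ̃(t₀, w₀)` for all `G` in the disc
algebra. By a Hahn–Banach argument the functional `G ↦ Re (G t₀ · w₀)` extends to all bounded
measurable functions with the same bound. Since `φ*` is finite on bounded sets, uniformly on the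
circle, the bound forces the extension to have a density `F ∈ L¹(ω)`, and by Fenchel–Moreau it gives
`∫ φ(s, F(s)) dω ≤ φ̃(t₀, w₀)`. The growth of `φ` then puts `F` in `Lᵖ`, and as `F` represents
evaluation at `t₀` on the disc algebra, it is the boundary function of an element of `Hᵖ` with
value `w₀` at `t₀`.

Along this `F` every competitor for the hull is `P[φ(s, F(s))]` minus the Poisson integral of a
nonnegative function. The latter can be made arbitrarily small at `t₀`, hence, by Harnack's
inequality, at every `t`.
-/

namespace DiscInterpolation

section Extension

variable {X : Type*} [AddCommGroup X] [Module ℝ X]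

theorem eq_zero_or_mem_convexConeHull {s : Set X} {x : X} (hx : x ∈ PointedCone.hull ℝ s) :
    x = 0 ∨ x ∈ ConvexCone.hull ℝ s := by
  induction hx using Submodule.span_induction with
  | mem x hx => exact .inr (ConvexCone.subset_hull hx)
  | zero => exact .inl rfl
  | add x y _ _ hx hy =>
    rcases hx with rfl | hx
    · rwa [zero_add]
    rcases hy with rfl | hy
    · rw [add_zero]
      exact .inr hx
    · exact .inr (ConvexCone.add_mem _ hx hy)
  | smul a x _ hx =>
    rcases hx with rfl | hx
    · exact .inl (smul_zero a)
    rcases eq_or_ne a 0 with rfl | ha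
    · exact .inl (zero_smul _ x)
    · exact .inr (ConvexCone.smul_mem _ (a.2.lt_of_ne' (NNReal.coe_ne_zero.2 ha)) hx)

/- The functional `(x, r) ↦ r - f x` is nonnegative on the epigraph of `Ψ`, hence on the cone that
the epigraph generates, and M. Riesz' theorem extends it. -/
theorem exists_extension_of_le_convexOn (f : X →ₗ.[ℝ] ℝ) {Ψ : X → ℝ} (hΨ : ConvexOn ℝ univ Ψ)
    (hf : ∀ x : f.domain, f x ≤ Ψ x) :
    ∃ g : X →ₗ[ℝ] ℝ, (∀ x : f.domain, g x = f x) ∧ ∀ x, g x ≤ Ψ x := by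
  have hepi : Convex ℝ {p : X × ℝ | Ψ p.1 ≤ p.2} := by simpa using hΨ.convex_epigraph
  let L : (X × ℝ) →ₗ.[ℝ] ℝ := (-f).coprod (LinearMap.id.toPMap ⊤)
  have hL (p : L.domain) : L p = p.1.2 - f ⟨p.1.1, p.2.1⟩ := (sub_eq_neg_add _ _).symm
  have hnonneg (p : L.domain) (hp : p.1 ∈ PointedCone.hull ℝ {p : X × ℝ | Ψ p.1 ≤ p.2}) :
      0 ≤ L p := by
    obtain ⟨p, hpL⟩ := p
    rcases eq_zero_or_mem_convexConeHull hp with hp | hp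
    · exact ((congrArg L (Subtype.ext hp)).trans L.map_zero).ge
    · obtain ⟨c, hc, y, hy, rfl⟩ := (ConvexCone.mem_hull_of_convex hepi).1 hp
      have hyL : y ∈ L.domain := (L.domain.smul_mem_iff hc.ne').1 hpL
      rw [show (⟨c • y, hpL⟩ : L.domain) = c • ⟨y, hyL⟩ from rfl, L.map_smul, hL]
      exact mul_nonneg hc.le (sub_nonneg.2 ((hf ⟨y.1, hyL.1⟩).trans hy))
  obtain ⟨G, hGL, hG⟩ := riesz_extension _ L hnonneg fun p =>
    ⟨⟨(0, Ψ p.1 - p.2), f.domain.zero_mem, trivial⟩, PointedCone.subset_hull (by simp)⟩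
  have hGf (x : f.domain) (r : ℝ) : G (x, r) = r - f x := by
    rw [← hL ⟨(x, r), x.2, trivial⟩, ← hGL]
  have hG_add (x : X) (r : ℝ) : G (x, r) = G (x, 0) + r := by
    have h₀ : G (0, r) = r := by simpa using hGf 0 r
    rw [← h₀, ← map_add, h₀]
    simp
  refine ⟨-G.comp (LinearMap.inl ℝ X ℝ), fun x => ?_, fun x => ?_⟩
  · simp [hGf]
  · have hx := hG (x, Ψ x) (PointedCone.subset_hull (le_refl (Ψ x)))
    rw [hG_add] at hx
    simpa using neg_le_iff_add_nonneg'.2 hx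

end Extension

section

variable {S : Type*} [MeasurableSpace S]

section BoundedMeasurable

variable {E : Type*} [NormedAddCommGroup E] [NormedSpace ℝ E] [MeasurableSpace E] [BorelSpace E]
  [SecondCountableTopology E]

/-- The vector space of bounded measurable functions: everywhere defined functions, not classes
modulo almost everywhere equality. Integral functionals are dominated on it. -/
def boundedMeasurable (S E : Type*) [MeasurableSpace S] [NormedAddCommGroup E] [NormedSpace ℝ E]
    [MeasurableSpace E] [BorelSpace E] [SecondCountableTopology E] : Submodule ℝ (S → E) where
  carrier := {g | Measurable g ∧ ∃ C, ∀ s, ‖g s‖ ≤ C}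
  zero_mem' := ⟨measurable_const, 0, fun _ => norm_zero.le⟩
  add_mem' := by
    rintro f g ⟨hf, C, hC⟩ ⟨hg, D, hD⟩
    exact ⟨hf.add hg, C + D, fun s => (norm_add_le _ _).trans (add_le_add (hC s) (hD s))⟩
  smul_mem' := by
    rintro a f ⟨hf, C, hC⟩
    refine ⟨hf.const_smul a, ‖a‖ * C, fun s => (norm_smul_le a _).trans ?_⟩
    gcongr
    exact hC s

theorem integrable_boundedMeasurable {μ : Measure S} [IsFiniteMeasure μ]
    (g : boundedMeasurable S E) : Integrable g.1 μ :=
  let ⟨C, hC⟩ := g.2.2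
  .of_bound g.2.1.aestronglyMeasurable C (ae_of_all _ hC)

/-- A simple function, as a bounded measurable function. -/
def ofSimpleFunc : SimpleFunc S E →ₗ[ℝ] boundedMeasurable S E where
  toFun f := ⟨f, f.measurable, f.exists_forall_norm_le⟩
  map_add' _ _ := rfl
  map_smul' _ _ := rfl

theorem ofSimpleFunc_apply (f : SimpleFunc S E) (s : S) : (ofSimpleFunc f).1 s = f s :=
  rfl

/-- The pointwise product of a bounded scalar function and a fixed vector. -/
def boundedSMul (v : E) : boundedMeasurable S ℝ →ₗ[ℝ] boundedMeasurable S E where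
  toFun g := ⟨fun s => g.1 s • v, g.2.1.smul_const v, by
    obtain ⟨C, hC⟩ := g.2.2
    refine ⟨C * ‖v‖, fun s => (norm_smul_le _ v).trans ?_⟩
    gcongr
    exact hC s⟩
  map_add' f g := Subtype.ext (funext fun s => add_smul (f.1 s) (g.1 s) v)
  map_smul' a g := Subtype.ext (funext fun s => smul_assoc a (g.1 s) v)

theorem exists_simpleFunc_dist_le [ProperSpace E] (g : boundedMeasurable S E) {ε : ℝ}
    (hε : 0 < ε) : ∃ f : SimpleFunc S E, ∀ s, ‖g.1 s - f s‖ ≤ ε := by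
  obtain ⟨hg, C, hC⟩ := g.2
  let e : ℕ → E := TopologicalSpace.denseSeq E
  obtain ⟨t, ht⟩ := (isCompact_closedBall (0 : E) C).elim_finite_subcover
    (fun k => ball (e k) ε) (fun _ => isOpen_ball) fun x _ => mem_iUnion.2 <| by
      obtain ⟨k, hk⟩ := (TopologicalSpace.denseRange_denseSeq E).exists_dist_lt x hε
      exact ⟨k, hk⟩
  refine ⟨(SimpleFunc.nearestPt e (t.sup id)).comp g.1 hg, fun s => ?_⟩
  obtain ⟨k, hkt, hk⟩ := mem_iUnion₂.1 (ht (mem_closedBall_zero_iff.2 (hC s)))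
  have hnear := SimpleFunc.edist_nearestPt_le e (g.1 s) (Finset.le_sup (f := id) hkt)
  rw [edist_dist, edist_dist, ENNReal.ofReal_le_ofReal_iff dist_nonneg] at hnear
  rw [SimpleFunc.coe_comp, Function.comp_apply, ← dist_eq_norm, dist_comm]
  exact hnear.trans ((dist_comm _ _).trans_le (mem_ball.1 hk).le)

/-- Continuity of a functional on the unit ball of the supremum norm for the norm of `L¹(μ)`. It
replaces weak-* continuity: such functionals are the ones with a density. -/
def ContinuousInMean (μ : Measure S) (Λ : boundedMeasurable S E →ₗ[ℝ] ℝ) : Prop :=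
  ∀ ε > 0, ∃ δ > 0, ∀ g, (∀ s, ‖g.1 s‖ ≤ 1) → ∫ s, ‖g.1 s‖ ∂μ ≤ δ → |Λ g| ≤ ε

namespace ContinuousInMean

variable {μ : Measure S} {Λ : boundedMeasurable S E →ₗ[ℝ] ℝ}

theorem tendsto_zero {ι : Type*} {l : Filter ι} {g : ι → boundedMeasurable S E}
    (hΛ : ContinuousInMean μ Λ) (hg : ∀ᶠ i in l, ∀ s, ‖(g i).1 s‖ ≤ 1)
    (hint : Tendsto (fun i => ∫ s, ‖(g i).1 s‖ ∂μ) l (𝓝 0)) :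
    Tendsto (fun i => Λ (g i)) l (𝓝 0) := by
  refine Metric.nhds_basis_closedBall.tendsto_right_iff.2 fun ε hε => ?_
  obtain ⟨δ, hδ, H⟩ := hΛ ε hε
  filter_upwards [hg, hint.eventually_le_const hδ] with i hi hiδ
  rw [mem_closedBall_zero_iff, Real.norm_eq_abs]
  exact H _ hi hiδ

theorem comp_boundedSMul (hΛ : ContinuousInMean μ Λ) {v : E} (hv : ‖v‖ = 1) :
    ContinuousInMean μ (Λ.comp (boundedSMul v)) := fun ε hε => by
  obtain ⟨δ, hδ, H⟩ := hΛ ε hε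
  have hnorm (g : boundedMeasurable S ℝ) (s : S) : ‖(boundedSMul v g).1 s‖ = ‖g.1 s‖ := by
    rw [← mul_one ‖g.1 s‖, ← hv]
    exact norm_smul (g.1 s) v
  refine ⟨δ, hδ, fun g hg hgδ => H _ (fun s => (hnorm g s).trans_le (hg s)) ?_⟩
  simpa only [hnorm] using hgδ

theorem eq_of_forall_simpleFunc_eq [ProperSpace E] [IsFiniteMeasure μ]
    {Λ' : boundedMeasurable S E →ₗ[ℝ] ℝ} (hΛ : ContinuousInMean μ Λ)
    (hΛ' : ContinuousInMean μ Λ') (h : ∀ f, Λ (ofSimpleFunc f) = Λ' (ofSimpleFunc f)) :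
    Λ = Λ' := by
  ext g
  choose f hf using fun k : ℕ => exists_simpleFunc_dist_le g (Nat.one_div_pos_of_nat (n := k))
  have hbd (k : ℕ) (s : S) : ‖(g - ofSimpleFunc (f k)).1 s‖ ≤ 1 / ((k : ℝ) + 1) := hf k s
  have hle (k : ℕ) (s : S) : ‖(g - ofSimpleFunc (f k)).1 s‖ ≤ 1 :=
    (hbd k s).trans (div_le_one_of_le₀ (by simp) (by positivity))
  have hint : Tendsto (fun k => ∫ s, ‖(g - ofSimpleFunc (f k)).1 s‖ ∂μ) atTop (𝓝 0) := by
    refine squeeze_zero (fun k => integral_nonneg fun s => norm_nonneg _) (fun k => ?_)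
      (by simpa only [mul_zero] using
        tendsto_one_div_add_atTop_nhds_zero_nat.const_mul (μ.real univ))
    calc ∫ s, ‖(g - ofSimpleFunc (f k)).1 s‖ ∂μ ≤ ∫ _, 1 / ((k : ℝ) + 1) ∂μ :=
          integral_mono (integrable_boundedMeasurable _).norm (integrable_const _) (hbd k)
      _ = μ.real univ * (1 / ((k : ℝ) + 1)) := by rw [integral_const, smul_eq_mul]
  have hlim := (hΛ.tendsto_zero (.of_forall hle) hint).sub (hΛ'.tendsto_zero (.of_forall hle) hint)
  simp only [map_sub, h, sub_sub_sub_cancel_right, sub_zero] at hlim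
  exact sub_eq_zero.1 (tendsto_nhds_unique tendsto_const_nhds hlim)

end ContinuousInMean

end BoundedMeasurable

section Density

variable {μ : Measure S}

/-- The indicator function of a measurable set, as a bounded measurable function. -/
noncomputable def boundedIndicator {A : Set S} (hA : MeasurableSet A) : boundedMeasurable S ℝ :=
  ofSimpleFunc (.piecewise A hA (.const S 1) (.const S 0))

theorem boundedIndicator_apply {A : Set S} (hA : MeasurableSet A) (s : S) :
    (boundedIndicator hA).1 s = A.indicator 1 s := by
  classical
  rw [boundedIndicator, ofSimpleFunc_apply, SimpleFunc.piecewise_apply, indicator_apply]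
  rfl

theorem norm_boundedIndicator_le {A : Set S} (hA : MeasurableSet A) (s : S) :
    ‖(boundedIndicator hA).1 s‖ ≤ 1 := by
  rw [boundedIndicator_apply]
  exact (norm_indicator_le_norm_self _ s).trans norm_one.le

theorem integral_norm_boundedIndicator {A : Set S} (hA : MeasurableSet A) :
    ∫ s, ‖(boundedIndicator hA).1 s‖ ∂μ = μ.real A := by
  simp only [boundedIndicator_apply, norm_indicator_eq_indicator_norm, Pi.one_apply, norm_one]
  exact integral_indicator_one hA

theorem ContinuousInMean.hasSum_boundedIndicator [IsFiniteMeasure μ]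
    {Λ : boundedMeasurable S ℝ →ₗ[ℝ] ℝ} (hΛ : ContinuousInMean μ Λ) {A : ℕ → Set S}
    (hA : ∀ i, MeasurableSet (A i)) (hdisj : Pairwise (Function.onFun Disjoint A)) :
    HasSum (fun i => Λ (boundedIndicator (hA i))) (Λ (boundedIndicator (.iUnion hA))) := by
  have hrest (t : Finset ℕ) : MeasurableSet ((⋃ i, A i) \ ⋃ i ∈ t, A i) :=
    (MeasurableSet.iUnion hA).diff (t.measurableSet_biUnion fun i _ => hA i)
  have hsub (t : Finset ℕ) : ⋃ i ∈ t, A i ⊆ ⋃ i, A i := iUnion₂_subset fun i _ => subset_iUnion A i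
  have hsplit (t : Finset ℕ) : ∑ i ∈ t, boundedIndicator (hA i) =
      boundedIndicator (.iUnion hA) - boundedIndicator (hrest t) := by
    ext s
    simp only [AddSubmonoidClass.coe_finsetSum, Finset.sum_apply, AddSubgroupClass.coe_sub,
      Pi.sub_apply, boundedIndicator_apply]
    rw [indicator_sdiff (hsub t), Finset.indicator_biUnion t A fun i _ j _ hij => hdisj hij]
    simp
  have hmeas (t : Finset ℕ) : ∫ s, ‖(boundedIndicator (hrest t)).1 s‖ ∂μ =
      μ.real (⋃ i, A i) - ∑ i ∈ t, μ.real (A i) := by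
    rw [integral_norm_boundedIndicator,
      measureReal_sdiff (hsub t) (t.measurableSet_biUnion fun i _ => hA i),
      measureReal_biUnion_finset (fun i _ j _ hij => hdisj hij) fun i _ => hA i]
  have hreal : HasSum (fun i => μ.real (A i)) (μ.real (⋃ i, A i)) := by
    have hfin := measure_iUnion hdisj hA ▸ measure_ne_top μ (⋃ i, A i)
    rw [measureReal_def, measure_iUnion hdisj hA,
      ENNReal.tsum_toReal_eq fun i => measure_ne_top μ _]
    exact ENNReal.hasSum_toReal hfin
  rw [HasSum, SummationFilter.unconditional_filter] at hreal ⊢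
  have hzero := hΛ.tendsto_zero (.of_forall fun t s => norm_boundedIndicator_le (hrest t) s)
    (by simpa only [hmeas, sub_self] using hreal.const_sub (μ.real (⋃ i, A i)))
  simpa only [← map_sum, hsplit, map_sub, sub_zero] using
    hzero.const_sub (Λ (boundedIndicator (.iUnion hA)))

open Classical in
/-- The set function `A ↦ Λ 1_A` of a functional with the continuity of `ContinuousInMean`, which
makes it countably additive. -/
noncomputable def ContinuousInMean.signedMeasure [IsFiniteMeasure μ]
    {Λ : boundedMeasurable S ℝ →ₗ[ℝ] ℝ} (hΛ : ContinuousInMean μ Λ) : SignedMeasure S where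
  measureOf' A := if hA : MeasurableSet A then Λ (boundedIndicator hA) else 0
  empty' := by
    have h : boundedIndicator (S := S) .empty = 0 := by
      ext s
      rw [boundedIndicator_apply, indicator_empty]
      rfl
    rw [dif_pos .empty, h, map_zero]
  not_measurable' A hA := dif_neg hA
  m_iUnion' A hA hdisj := by
    simpa only [hA, MeasurableSet.iUnion hA, dite_true] using hΛ.hasSum_boundedIndicator hA hdisj

theorem ContinuousInMean.signedMeasure_apply [IsFiniteMeasure μ]
    {Λ : boundedMeasurable S ℝ →ₗ[ℝ] ℝ} (hΛ : ContinuousInMean μ Λ) {A : Set S}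
    (hA : MeasurableSet A) : hΛ.signedMeasure A = Λ (boundedIndicator hA) :=
  dif_pos hA

theorem ContinuousInMean.signedMeasure_absolutelyContinuous [IsFiniteMeasure μ]
    {Λ : boundedMeasurable S ℝ →ₗ[ℝ] ℝ} (hΛ : ContinuousInMean μ Λ) :
    hΛ.signedMeasure ≪ᵥ μ.toENNRealVectorMeasure := by
  refine VectorMeasure.AbsolutelyContinuous.mk fun A hA hμ => ?_
  rw [Measure.toENNRealVectorMeasure_apply_measurable hA] at hμ
  rw [hΛ.signedMeasure_apply hA, ← abs_nonpos_iff]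
  refine le_of_forall_pos_le_add fun ε hε => ?_
  obtain ⟨δ, hδ, H⟩ := hΛ ε hε
  rw [zero_add]
  refine H _ (norm_boundedIndicator_le hA) ?_
  rw [integral_norm_boundedIndicator, measureReal_def, hμ]
  exact hδ.le

section Inner

variable {E : Type*} [NormedAddCommGroup E] [InnerProductSpace ℝ E] [MeasurableSpace E]
  [BorelSpace E] [SecondCountableTopology E]

theorem integrable_boundedMeasurable_inner {F : S → E} (hF : Integrable F μ)
    (g : boundedMeasurable S E) : Integrable (fun s => inner ℝ (g.1 s) (F s)) μ := by
  obtain ⟨hg, C, hC⟩ := g.2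
  refine (hF.norm.const_mul C).mono' (hg.aestronglyMeasurable.inner hF.aestronglyMeasurable)
    (ae_of_all _ fun s => (norm_inner_le_norm _ _).trans ?_)
  gcongr
  exact hC s

/-- The functional `g ↦ ∫ ⟪g, F⟫ ∂μ` with density `F`. -/
noncomputable def integralInner {F : S → E} (hF : Integrable F μ) :
    boundedMeasurable S E →ₗ[ℝ] ℝ where
  toFun g := ∫ s, inner ℝ (g.1 s) (F s) ∂μ
  map_add' f g := by
    rw [← integral_add (integrable_boundedMeasurable_inner hF f)
      (integrable_boundedMeasurable_inner hF g)]
    exact integral_congr_ae (ae_of_all _ fun s => inner_add_left _ _ _)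
  map_smul' a g := by
    rw [RingHom.id_apply, smul_eq_mul, ← integral_const_mul]
    exact integral_congr_ae (ae_of_all _ fun s => real_inner_smul_left _ _ _)

/- For `‖g‖ ≤ 1` the integrand is at most `k ‖g‖ + (‖F‖ - k)⁺`, and the integral of the second
term is small for large `k`. -/
theorem continuousInMean_integralInner [IsFiniteMeasure μ] {F : S → E} (hF : Integrable F μ) :
    ContinuousInMean μ (integralInner hF) := by
  intro ε hε
  have htrunc (k : ℕ) : Integrable (fun s => max (‖F s‖ - k) 0) μ :=
    (hF.norm.sub (integrable_const _)).sup (integrable_const _)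
  have hlim : Tendsto (fun k : ℕ => ∫ s, max (‖F s‖ - k) 0 ∂μ) atTop (𝓝 (∫ _, (0 : ℝ) ∂μ)) := by
    refine tendsto_integral_of_dominated_convergence (fun s => ‖F s‖)
      (fun k => (htrunc k).aestronglyMeasurable) hF.norm (fun k => ae_of_all _ fun s => ?_)
      (ae_of_all _ fun s => ?_)
    · rw [Real.norm_of_nonneg (le_max_right _ _)]
      exact max_le (sub_le_self _ k.cast_nonneg) (norm_nonneg _)
    · refine tendsto_const_nhds.congr' ?_
      filter_upwards [eventually_ge_atTop ⌈‖F s‖⌉₊] with k hk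
      exact (max_eq_right (sub_nonpos.2 (Nat.ceil_le.1 hk))).symm
  rw [integral_zero] at hlim
  obtain ⟨k, hk⟩ := (hlim.eventually_le_const (half_pos hε)).exists
  refine ⟨ε / (2 * (k + 1)), by positivity, fun g hg hgδ => ?_⟩
  have hbound (s : S) : ‖inner ℝ (g.1 s) (F s)‖ ≤ k * ‖g.1 s‖ + max (‖F s‖ - k) 0 := by
    have hexcess : ‖g.1 s‖ * (‖F s‖ - k) ≤ max (‖F s‖ - k) 0 :=
      (mul_le_mul_of_nonneg_left (le_max_left _ _) (norm_nonneg _)).trans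
        (mul_le_of_le_one_left (le_max_right _ _) (hg s))
    linarith [norm_inner_le_norm (𝕜 := ℝ) (g.1 s) (F s)]
  have hgnorm := (integrable_boundedMeasurable (μ := μ) g).norm
  calc |∫ s, inner ℝ (g.1 s) (F s) ∂μ|
      ≤ ∫ s, (k * ‖g.1 s‖ + max (‖F s‖ - k) 0) ∂μ :=
        norm_integral_le_of_norm_le ((hgnorm.const_mul _).add (htrunc k)) (ae_of_all _ hbound)
    _ = k * ∫ s, ‖g.1 s‖ ∂μ + ∫ s, max (‖F s‖ - k) 0 ∂μ := by
        rw [integral_add (hgnorm.const_mul _) (htrunc k), integral_const_mul]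
    _ ≤ k * (ε / (2 * (k + 1))) + ε / 2 := by gcongr
    _ ≤ ε / 2 + ε / 2 := by
        gcongr
        rw [mul_div_assoc', div_le_iff₀ (by positivity)]
        nlinarith
    _ = ε := add_halves ε

end Inner

theorem ContinuousInMean.exists_real_density [IsFiniteMeasure μ]
    {Λ : boundedMeasurable S ℝ →ₗ[ℝ] ℝ} (hΛ : ContinuousInMean μ Λ) :
    ∃ (h : S → ℝ) (hh : Integrable h μ), Λ = integralInner hh := by
  have hh : Integrable (hΛ.signedMeasure.rnDeriv μ) μ := SignedMeasure.integrable_rnDeriv _ _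
  refine ⟨_, hh, hΛ.eq_of_forall_simpleFunc_eq (continuousInMean_integralInner hh) fun f => ?_⟩
  have hindicator {A : Set S} (hA : MeasurableSet A) :
      Λ (boundedIndicator hA) = integralInner hh (boundedIndicator hA) := by
    calc Λ (boundedIndicator hA) = ∫ s in A, hΛ.signedMeasure.rnDeriv μ s ∂μ := by
          rw [← withDensityᵥ_apply hh hA, SignedMeasure.withDensityᵥ_rnDeriv_eq _ μ
            hΛ.signedMeasure_absolutelyContinuous, hΛ.signedMeasure_apply hA]
      _ = integralInner hh (boundedIndicator hA) := by
          rw [← integral_indicator hA]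
          refine integral_congr_ae (ae_of_all _ fun s => ?_)
          by_cases hs : s ∈ A <;> simp [boundedIndicator_apply, hs]
  induction f using SimpleFunc.induction with
  | @const c A hA =>
    have hc : ofSimpleFunc (.piecewise A hA (.const S c) (.const S 0)) =
        c • boundedIndicator hA := by
      ext s
      change (ofSimpleFunc _).1 s = c • (boundedIndicator hA).1 s
      by_cases hs : s ∈ A <;> simp [boundedIndicator_apply, ofSimpleFunc_apply, hs]
    rw [hc, map_smul, map_smul, hindicator]
  | add _ hf hg => rw [map_add, map_add, map_add, hf, hg]

theorem ContinuousInMean.exists_density [IsFiniteMeasure μ] {E : Type*}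
    [NormedAddCommGroup E] [InnerProductSpace ℝ E] [FiniteDimensional ℝ E] [MeasurableSpace E]
    [BorelSpace E] {Λ : boundedMeasurable S E →ₗ[ℝ] ℝ} (hΛ : ContinuousInMean μ Λ) :
    ∃ F : S → E, Measurable F ∧ Integrable F μ ∧ ∀ g, Λ g = ∫ s, inner ℝ (g.1 s) (F s) ∂μ := by
  let b := stdOrthonormalBasis ℝ E
  choose h hh hΛh using fun i => (hΛ.comp_boundedSMul (b.orthonormal.1 i)).exists_real_density
  have hint : Integrable (fun s => ∑ i, h i s • b i) μ :=
    integrable_finsetSum _ fun i _ => (hh i).smul_const _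
  obtain ⟨F, hF, hhF⟩ := hint.aestronglyMeasurable
  refine ⟨F, hF.measurable, hint.congr hhF, fun g => ?_⟩
  obtain ⟨hg, C, hC⟩ := g.2
  let coord (i : Fin (Module.finrank ℝ E)) : boundedMeasurable S ℝ :=
    ⟨fun s => inner ℝ (b i) (g.1 s), hg.const_inner, C, fun s =>
      (norm_inner_le_norm _ _).trans (by rw [b.orthonormal.1 i, one_mul]; exact hC s)⟩
  have hsum : g = ∑ i, boundedSMul (b i) (coord i) := by
    ext s
    rw [AddSubmonoidClass.coe_finsetSum, Finset.sum_apply]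
    exact (b.sum_repr' (g.1 s)).symm
  calc Λ g = ∑ i, ∫ s, inner ℝ ((coord i).1 s) (h i s) ∂μ := by
        conv_lhs => rw [hsum, map_sum]
        exact Finset.sum_congr rfl fun i _ => LinearMap.congr_fun (hΛh i) (coord i)
    _ = ∫ s, ∑ i, inner ℝ ((coord i).1 s) (h i s) ∂μ :=
        (integral_finsetSum _ fun i _ => integrable_boundedMeasurable_inner (hh i) _).symm
    _ = ∫ s, inner ℝ (g.1 s) (F s) ∂μ := by
        refine integral_congr_ae (hhF.mono fun s hs => ?_)
        simp only [← hs, inner_sum, real_inner_smul_right, coord]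
        exact Finset.sum_congr rfl fun i _ => by rw [real_inner_comm (b i)]; rfl

end Density

end

section

variable {S : Type*} [MeasurableSpace S] {μ : Measure S}

theorem exists_integrable_majorant_of_monotone {u : ℕ → S → ℝ} {m : ℝ} (hmono : Monotone u)
    (hint : ∀ k, Integrable (u k) μ) (hle : ∀ k, ∫ s, u k s ∂μ ≤ m) :
    ∃ U : S → ℝ, Integrable U μ ∧ ∫ s, U s ∂μ ≤ m ∧ ∀ᵐ s ∂μ, ∀ k, u k s ≤ U s := by
  let v (k : ℕ) (s : S) : ℝ≥0∞ := ENNReal.ofReal (u k s - u 0 s)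
  have hv (k : ℕ) : AEMeasurable (v k) μ :=
    ((hint k).sub (hint 0)).aestronglyMeasurable.aemeasurable.ennreal_ofReal
  have hvm : AEMeasurable (fun s => ⨆ k, v k s) μ := .iSup hv
  have hvint : ∫⁻ s, ⨆ k, v k s ∂μ ≤ ENNReal.ofReal (m - ∫ s, u 0 s ∂μ) := by
    rw [lintegral_iSup' hv (ae_of_all _ fun s i j hij =>
      ENNReal.ofReal_le_ofReal (sub_le_sub_right (hmono hij s) _))]
    refine iSup_le fun k => ?_
    rw [← ofReal_integral_eq_lintegral_ofReal (f := fun s => u k s - u 0 s) ((hint k).sub (hint 0))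
      (ae_of_all _ fun s => sub_nonneg.2 (hmono k.zero_le s)), integral_sub (hint k) (hint 0)]
    exact ENNReal.ofReal_le_ofReal (sub_le_sub_right (hle k) _)
  have hfin : ∫⁻ s, ⨆ k, v k s ∂μ ≠ ∞ := (hvint.trans_lt ENNReal.ofReal_lt_top).ne
  have hsup := integrable_toReal_of_lintegral_ne_top hvm hfin
  refine ⟨fun s => (⨆ k, v k s).toReal + u 0 s, hsup.add (hint 0), ?_, ?_⟩
  · rw [integral_add hsup (hint 0), integral_toReal hvm (ae_lt_top' hvm hfin), ← le_sub_iff_add_le]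
    exact ENNReal.toReal_le_of_le_ofReal (sub_nonneg.2 (hle 0)) hvint
  · filter_upwards [ae_lt_top' hvm hfin] with s hs k
    rw [← sub_le_iff_le_add, ← ENNReal.ofReal_le_iff_le_toReal hs.ne]
    exact le_iSup (fun k => v k s) k

theorem apply_smul_le_of_convexOn {E : Type*} [NormedAddCommGroup E] [NormedSpace ℝ E]
    {u : E → ℝ} (hu : ConvexOn ℝ univ u)
    {M₀ M R : ℝ} (hR : 0 ≤ R) (hM₀ : u 0 ≤ M₀) (hM : ∀ z, ‖z‖ ≤ R → u z ≤ M) {z : E}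
    (hz : ‖z‖ ≤ 1) : u (R • z) ≤ ‖z‖ * M + (1 - ‖z‖) * M₀ := by
  rcases eq_or_ne z 0 with rfl | hz₀
  · simpa using hM₀
  have hsplit : R • z = ‖z‖ • (R * ‖z‖⁻¹) • z + (1 - ‖z‖) • (0 : E) := by
    rw [smul_zero, add_zero, smul_smul, mul_left_comm, mul_inv_cancel₀ (norm_ne_zero_iff.2 hz₀),
      mul_one]
  have hnorm : ‖(R * ‖z‖⁻¹) • z‖ = R := by
    rw [norm_smul, Real.norm_of_nonneg (by positivity), inv_mul_cancel_right₀]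
    exact norm_ne_zero_iff.2 hz₀
  calc u (R • z) ≤ ‖z‖ * u ((R * ‖z‖⁻¹) • z) + (1 - ‖z‖) * u 0 := by
        rw [hsplit]
        exact hu.2 trivial trivial (norm_nonneg z) (sub_nonneg.2 hz) (add_sub_cancel _ _)
    _ ≤ ‖z‖ * M + (1 - ‖z‖) * M₀ := by
        gcongr
        exact hM _ hnorm.le

variable {E : Type*} [NormedAddCommGroup E] [MeasurableSpace E] [BorelSpace E]
  [SecondCountableTopology E]

theorem exists_boundedMeasurable_apply_eq_max [NormedSpace ℝ E] {h : S → E → ℝ}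
    (hh : Measurable fun x : S × E => h x.1 x.2) (g₁ g₂ : boundedMeasurable S E) :
    ∃ g : boundedMeasurable S E, ∀ s, h s (g.1 s) = max (h s (g₁.1 s)) (h s (g₂.1 s)) := by
  classical
  obtain ⟨C₁, hC₁⟩ := g₁.2.2
  obtain ⟨C₂, hC₂⟩ := g₂.2.2
  have hcomp (g : boundedMeasurable S E) : Measurable fun s => h s (g.1 s) :=
    hh.comp (measurable_id.prodMk g.2.1)
  refine ⟨⟨fun s => if h s (g₁.1 s) ≤ h s (g₂.1 s) then g₂.1 s else g₁.1 s,
    .ite (measurableSet_le (hcomp g₁) (hcomp g₂)) g₂.2.1 g₁.2.1, max C₁ C₂, fun s => ?_⟩,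
    fun s => ?_⟩
  · dsimp only
    split_ifs
    · exact (hC₂ s).trans (le_max_right _ _)
    · exact (hC₁ s).trans (le_max_left _ _)
  · dsimp only
    split_ifs with hle
    · exact (max_eq_right hle).symm
    · exact (max_eq_left (not_le.1 hle).le).symm

theorem exists_boundedMeasurable_apply_eq_partialSups [NormedSpace ℝ E] {h : S → E → ℝ}
    (hh : Measurable fun x : S × E => h x.1 x.2) (z : ℕ → E) (k : ℕ) :
    ∃ g : boundedMeasurable S E, ∀ s, h s (g.1 s) = partialSups (fun j s => h s (z j)) k s := by
  have hconst (v : E) (s : S) : (ofSimpleFunc (.const S v)).1 s = v := rfl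
  induction k with
  | zero => exact ⟨ofSimpleFunc (.const S (z 0)), fun s => by rw [partialSups_zero, hconst]⟩
  | succ k ih =>
    obtain ⟨g, hg⟩ := ih
    obtain ⟨g', hg'⟩ :=
      exists_boundedMeasurable_apply_eq_max hh g (ofSimpleFunc (.const S (z (k + 1))))
    refine ⟨g', fun s => ?_⟩
    rw [hg', hg, hconst, partialSups_add_one]
    rfl

/-- A convex integrand on a real vector space: a jointly measurable `ψ(s, z)`, convex in `z`,
bounded below, and bounded above on bounded sets of `z`, uniformly in `s`. -/
structure IsConvexIntegrand [NormedSpace ℝ E] (ψ : S → E → ℝ) : Prop where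
  measurable : Measurable fun x : S × E => ψ x.1 x.2
  convexOn : ∀ s, ConvexOn ℝ univ (ψ s)
  bddBelow : ∃ A, ∀ s z, -A ≤ ψ s z
  bddAbove : ∀ R, ∃ M, ∀ s z, ‖z‖ ≤ R → ψ s z ≤ M

namespace IsConvexIntegrand

section NormedSpace

variable [NormedSpace ℝ E] [IsFiniteMeasure μ] {ψ : S → E → ℝ}

theorem integrable (hψ : IsConvexIntegrand ψ) (g : boundedMeasurable S E) :
    Integrable (fun s => ψ s (g.1 s)) μ := by
  obtain ⟨A, hA⟩ := hψ.bddBelow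
  obtain ⟨hg, C, hC⟩ := g.2
  obtain ⟨M, hM⟩ := hψ.bddAbove C
  exact .of_mem_Icc (-A) M (hψ.measurable.comp (measurable_id.prodMk hg)).aemeasurable
    (ae_of_all _ fun s => ⟨hA s _, hM s _ (hC s)⟩)

theorem convexOn_integral (hψ : IsConvexIntegrand ψ) :
    ConvexOn ℝ univ fun g : boundedMeasurable S E => ∫ s, ψ s (g.1 s) ∂μ := by
  refine ⟨convex_univ, fun f _ g _ a b ha hb hab => ?_⟩
  have hf := (hψ.integrable (μ := μ) f).const_mul a
  have hg := (hψ.integrable (μ := μ) g).const_mul b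
  calc ∫ s, ψ s ((a • f + b • g).1 s) ∂μ ≤ ∫ s, (a * ψ s (f.1 s) + b * ψ s (g.1 s)) ∂μ :=
        integral_mono (hψ.integrable _) (hf.add hg) fun s =>
          (hψ.convexOn s).2 trivial trivial ha hb hab
    _ = a • ∫ s, ψ s (f.1 s) ∂μ + b • ∫ s, ψ s (g.1 s) ∂μ := by
        rw [integral_add hf hg, integral_const_mul, integral_const_mul, smul_eq_mul, smul_eq_mul]

theorem exists_integral_smul_le (hψ : IsConvexIntegrand ψ) :
    ∃ K : ℝ, ∀ R : ℝ, 0 ≤ R → ∃ δ > 0, ∀ g : boundedMeasurable S E, (∀ s, ‖g.1 s‖ ≤ 1) →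
      ∫ s, ‖g.1 s‖ ∂μ ≤ δ → ∫ s, ψ s ((R • g).1 s) ∂μ ≤ K := by
  obtain ⟨M₀, hM₀⟩ := hψ.bddAbove 0
  refine ⟨1 + M₀ * μ.real univ, fun R hR => ?_⟩
  obtain ⟨M, hM⟩ := hψ.bddAbove R
  refine ⟨(|M - M₀| + 1)⁻¹, by positivity, fun g hg hgδ => ?_⟩
  have hgnorm := (integrable_boundedMeasurable (μ := μ) g).norm
  have hsmall : |M - M₀| * ∫ s, ‖g.1 s‖ ∂μ ≤ 1 :=
    (mul_le_mul_of_nonneg_left hgδ (abs_nonneg _)).trans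
      ((mul_inv_le_iff₀ (by positivity)).2 (by linarith))
  calc ∫ s, ψ s ((R • g).1 s) ∂μ ≤ ∫ s, (|M - M₀| * ‖g.1 s‖ + M₀) ∂μ := by
        refine integral_mono (hψ.integrable _) ((hgnorm.const_mul _).add (integrable_const _))
          fun s => ?_
        have hs := apply_smul_le_of_convexOn (hψ.convexOn s) hR (hM₀ s 0 norm_zero.le) (hM s) (hg s)
        have := mul_le_mul_of_nonneg_right (le_abs_self (M - M₀)) (norm_nonneg (g.1 s))
        change ψ s (R • g.1 s) ≤ _
        linarith
    _ = |M - M₀| * ∫ s, ‖g.1 s‖ ∂μ + M₀ * μ.real univ := by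
        rw [integral_add (hgnorm.const_mul _) (integrable_const _), integral_const_mul,
          integral_const, smul_eq_mul, mul_comm M₀]
    _ ≤ 1 + M₀ * μ.real univ := by gcongr

theorem continuousInMean (hψ : IsConvexIntegrand ψ) {Λ : boundedMeasurable S E →ₗ[ℝ] ℝ} {m : ℝ}
    (hΛ : ∀ g, Λ g ≤ ∫ s, ψ s (g.1 s) ∂μ + m) : ContinuousInMean μ Λ := by
  intro ε hε
  obtain ⟨K, hK⟩ := hψ.exists_integral_smul_le (μ := μ)
  have hKm : 0 < |K + m| + 1 := by positivity
  obtain ⟨δ, hδ, H⟩ := hK ((|K + m| + 1) / ε) (by positivity)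
  have hle (g : boundedMeasurable S E) (hg : ∀ s, ‖g.1 s‖ ≤ 1) (hgδ : ∫ s, ‖g.1 s‖ ∂μ ≤ δ) :
      Λ g ≤ ε := by
    have hscaled : (|K + m| + 1) / ε * Λ g ≤ K + m := by
      rw [← smul_eq_mul, ← map_smul]
      exact (hΛ _).trans (add_le_add_left (H g hg hgδ) m)
    rw [div_mul_eq_mul_div, div_le_iff₀ hε] at hscaled
    refine le_of_mul_le_mul_left (hscaled.trans ?_) hKm
    exact mul_le_mul_of_nonneg_right
      ((le_abs_self _).trans (le_add_of_nonneg_right one_pos.le)) hε.le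
  refine ⟨δ, hδ, fun g hg hgδ => abs_le'.2 ⟨hle g hg hgδ, ?_⟩⟩
  rw [← map_neg]
  have hneg (s : S) : ‖(-g).1 s‖ = ‖g.1 s‖ := norm_neg _
  exact hle (-g) (by simpa only [hneg] using hg) (by simpa only [hneg] using hgδ)

end NormedSpace

variable [InnerProductSpace ℝ E] {ψ : S → E → ℝ} [IsFiniteMeasure μ]

/- The supremum over finitely many vectors `z k` is attained along a bounded measurable function,
which the hypothesis `h` applies to. -/
theorem exists_integrable_majorant (hψ : IsConvexIntegrand ψ) {F : S → E} (hFm : Measurable F)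
    (hF : Integrable F μ) {m : ℝ}
    (h : ∀ g : boundedMeasurable S E,
      ∫ s, inner ℝ (g.1 s) (F s) ∂μ ≤ ∫ s, ψ s (g.1 s) ∂μ + m) (z : ℕ → E) :
    ∃ U : S → ℝ, Integrable U μ ∧ ∫ s, U s ∂μ ≤ m ∧
      ∀ᵐ s ∂μ, ∀ k, inner ℝ (z k) (F s) - ψ s (z k) ≤ U s := by
  have hmeas : Measurable fun x : S × E => inner ℝ x.2 (F x.1) - ψ x.1 x.2 :=
    (measurable_snd.inner (hFm.comp measurable_fst)).sub hψ.measurable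
  choose G hG using exists_boundedMeasurable_apply_eq_partialSups
    (h := fun s x => inner ℝ x (F s) - ψ s x) hmeas z
  have hint (k : ℕ) := (integrable_boundedMeasurable_inner hF (G k)).sub (hψ.integrable (G k))
  obtain ⟨U, hU, hUm, hle⟩ := exists_integrable_majorant_of_monotone
    (partialSups fun j s => inner ℝ (z j) (F s) - ψ s (z j)).monotone
    (fun k => (hint k).congr (ae_of_all _ (hG k))) (m := m) fun k => by
      simp only [← hG]
      rw [integral_sub (integrable_boundedMeasurable_inner hF _) (hψ.integrable _)]
      exact sub_le_iff_le_add'.2 (h (G k))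
  exact ⟨U, hU, hUm, hle.mono fun s hs k =>
    (le_partialSups (fun j s => inner ℝ (z j) (F s) - ψ s (z j)) k s).trans (hs k)⟩

theorem exists_dual [FiniteDimensional ℝ E] (hψ : IsConvexIntegrand ψ)
    (V : Submodule ℝ (boundedMeasurable S E)) (l : boundedMeasurable S E →ₗ[ℝ] ℝ) {m : ℝ}
    (hl : ∀ g ∈ V, l g ≤ ∫ s, ψ s (g.1 s) ∂μ + m) (z : ℕ → E) :
    ∃ F : S → E, Measurable F ∧ Integrable F μ ∧
      (∀ g ∈ V, l g = ∫ s, inner ℝ (g.1 s) (F s) ∂μ) ∧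
      ∃ U : S → ℝ, Integrable U μ ∧ ∫ s, U s ∂μ ≤ m ∧
        ∀ᵐ s ∂μ, ∀ k, inner ℝ (z k) (F s) - ψ s (z k) ≤ U s := by
  obtain ⟨Λ, hΛl, hΛ⟩ := exists_extension_of_le_convexOn ⟨V, l.domRestrict V⟩
    (hψ.convexOn_integral.add_const m) fun g => hl g g.2
  obtain ⟨F, hFm, hF, hΛF⟩ := (hψ.continuousInMean hΛ).exists_density
  exact ⟨F, hFm, hF, fun g hg => (hΛl ⟨g, hg⟩).symm.trans (hΛF g),
    hψ.exists_integrable_majorant hFm hF (fun g => (hΛF g).symm.trans_le (hΛ g)) z⟩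

end IsConvexIntegrand

end

section

section Epigraph

variable {E : Type*}

/-- The epigraph of an extended real valued function, as a set of pairs with a real second entry. -/
def epigraph (u : E → EReal) : Set (E × ℝ) :=
  {p | u p.1 ≤ p.2}

theorem isClosed_epigraph [TopologicalSpace E] {u : E → EReal} (hu : LowerSemicontinuous u) :
    IsClosed (epigraph u) :=
  hu.isClosed_epigraph.preimage
    (continuous_fst.prodMk (continuous_coe_real_ereal.comp continuous_snd))

variable [AddCommGroup E] [Module ℝ E]

theorem convex_epigraph_of_convexOn_toReal {u : E → EReal} (hbot : ∀ x, u x ≠ ⊥)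
    (hu : ConvexOn ℝ {x | u x < ⊤} fun x => (u x).toReal) : Convex ℝ (epigraph u) := by
  have hepi : epigraph u = {p | p.1 ∈ {x | u x < ⊤} ∧ (u p.1).toReal ≤ p.2} := by
    ext ⟨x, r⟩
    refine ⟨fun h => ⟨lt_of_le_of_lt h (EReal.coe_lt_top r), EReal.toReal_le_toReal h (hbot x)
      (EReal.coe_ne_top r)⟩, fun ⟨hx, h⟩ => ?_⟩
    exact (EReal.le_coe_toReal (ne_of_lt hx)).trans (EReal.coe_le_coe_iff.2 h)
  rw [hepi]
  exact hu.convex_epigraph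

variable [TopologicalSpace E] [IsTopologicalAddGroup E] [ContinuousSMul ℝ E]

/- The epigraph lies in the closure of its interior, and an open set in which a violation of the
inequality occurs contains a point above some `w j`. -/
theorem coe_le_of_denseRange {u : E → EReal} (hu : Convex ℝ (epigraph u))
    (hint : (interior (epigraph u)).Nonempty) {a : E → ℝ} (ha : Continuous a) {w : ℕ → E}
    (hw : DenseRange w) (h : ∀ j, (a (w j) : EReal) ≤ u (w j)) (x : E) : (a x : EReal) ≤ u x := by
  have hinterior : interior (epigraph u) ⊆ {p | a p.1 ≤ p.2} := by
    intro p hp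
    by_contra hlt
    have hopen : IsOpen (interior (epigraph u) ∩ {p | p.2 < a p.1}) :=
      isOpen_interior.inter (isOpen_lt continuous_snd (ha.comp continuous_fst))
    obtain ⟨⟨j, r⟩, hj, hjr⟩ := (hw.prodMap denseRange_id).exists_mem_open hopen
      ⟨p, hp, (lt_of_not_ge hlt : p.2 < a p.1)⟩
    have hjr_mem : (w j, r) ∈ epigraph u := interior_subset hj
    exact not_lt.2 ((h j).trans hjr_mem) (EReal.coe_lt_coe_iff.2 hjr)
  have hepi : epigraph u ⊆ {p | a p.1 ≤ p.2} := by
    refine subset_closure.trans ?_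
    rw [← hu.closure_interior_eq_closure_of_nonempty_interior hint]
    exact closure_minimal hinterior (isClosed_le (ha.comp continuous_fst) continuous_snd)
  refine le_of_not_gt fun hlt => ?_
  obtain ⟨r, hr, hra⟩ := EReal.lt_iff_exists_real_btwn.1 hlt
  exact not_lt.2 (@hepi (x, r) hr.le) (EReal.coe_lt_coe_iff.1 hra)

/- A hyperplane separating `(x, U)` from the epigraph may be vertical; adding a multiple of the
constant minorant `-A` tilts it. -/
theorem exists_affine_minorant_gt [LocallyConvexSpace ℝ E] {u : E → EReal}
    (hu : Convex ℝ (epigraph u)) (hlsc : LowerSemicontinuous u) (hne : (epigraph u).Nonempty)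
    {A : ℝ} (hA : ∀ p ∈ epigraph u, -A ≤ p.2) {x : E} {U : ℝ} (hU : (U : EReal) < u x) :
    ∃ (g : E →L[ℝ] ℝ) (c : ℝ), (∀ p ∈ epigraph u, g p.1 - c ≤ p.2) ∧ U < g x - c := by
  have hxU : (x, U) ∉ epigraph u := not_le.2 hU
  obtain ⟨f, k, hfx, hf⟩ := geometric_hahn_banach_point_closed hu (isClosed_epigraph hlsc) hxU
  have hsplit (y : E) (r : ℝ) : f (y, r) = f (y, 0) + f (0, 1) * r := by
    have hyr : (y, r) = (y, 0) + r • ((0 : E), (1 : ℝ)) := by simp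
    rw [hyr, map_add, map_smul, smul_eq_mul, mul_comm]
  have hslope : 0 ≤ f (0, 1) := by
    obtain ⟨⟨y, r⟩, hyr⟩ := hne
    by_contra! hneg
    have ht : 0 ≤ (k - f (y, r)) / f (0, 1) :=
      div_nonneg_of_nonpos (sub_neg.2 (hf _ hyr)).le hneg.le
    have hup : (y, r + (k - f (y, r)) / f (0, 1)) ∈ epigraph u :=
      le_trans hyr (EReal.coe_le_coe_iff.2 (le_add_of_nonneg_right ht))
    have := hf _ hup
    rw [hsplit, mul_add, mul_div_cancel₀ _ hneg.ne, hsplit y r] at this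
    linarith
  obtain ⟨ε, hε, hεU⟩ := exists_pos_mul_lt (sub_pos.2 hfx) (U + A)
  have hβ : 0 < f (0, 1) + ε := by positivity
  refine ⟨-((f (0, 1) + ε)⁻¹ • f.comp (.inl ℝ E ℝ)), -((k - ε * A) / (f (0, 1) + ε)),
    fun p hp => ?_, ?_⟩
  · have hk := hf p hp
    have hp₂ := mul_nonneg hε.le (neg_le_iff_add_nonneg.1 (hA p hp))
    rw [← Prod.mk.eta (p := p), hsplit] at hk
    change -((f (0, 1) + ε)⁻¹ * f (p.1, 0)) - -((k - ε * A) / (f (0, 1) + ε)) ≤ p.2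
    rw [inv_mul_eq_div, sub_neg_eq_add, neg_add_eq_sub, ← sub_div, div_le_iff₀ hβ]
    linarith
  · rw [hsplit] at hfx hεU
    change U < -((f (0, 1) + ε)⁻¹ * f (x, 0)) - -((k - ε * A) / (f (0, 1) + ε))
    rw [inv_mul_eq_div, sub_neg_eq_add, neg_add_eq_sub, ← sub_div, lt_div_iff₀ hβ]
    linarith

end Epigraph

variable {E : Type*} [NormedAddCommGroup E]

theorem interior_epigraph_nonempty {u : E → EReal} {δ B : ℝ} (hδ : 0 < δ)
    (hu : ∀ x, ‖x‖ < δ → u x ≤ B) : (interior (epigraph u)).Nonempty := by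
  refine ⟨(0, B + 1), interior_maximal (fun p hp => ?_) (isOpen_ball.prod isOpen_Ioi)
    ⟨mem_ball_self hδ, mem_Ioi.2 (lt_add_one B)⟩⟩
  exact (hu p.1 (mem_ball_zero_iff.1 hp.1)).trans (EReal.coe_le_coe_iff.2 (le_of_lt hp.2))

variable [InnerProductSpace ℝ E]

/-- A lower semicontinuous convex function with values in `(-∞, +∞]` that is at most `B` on the
ball of radius `δ` about the origin and at least `R ‖x‖ - N R` for every slope `R`. -/
structure IsSuperlinear (u : E → EReal) (δ B : ℝ) (N : ℝ → ℝ) : Prop where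
  convex_epigraph : Convex ℝ (epigraph u)
  lowerSemicontinuous : LowerSemicontinuous u
  pos : 0 < δ
  le : ∀ x, ‖x‖ < δ → u x ≤ B
  ge : ∀ R x, ((R * ‖x‖ - N R : ℝ) : EReal) ≤ u x

/-- The convex conjugate `z ↦ sup_x (⟪z, x⟫ - u x)`. The supremum is taken over the epigraph of
`u`, so that only real numbers occur; it is `0` by convention if it is not finite. -/
noncomputable def conjugate (u : E → EReal) (z : E) : ℝ :=
  ⨆ p : epigraph u, (inner ℝ z p.1.1 - p.1.2)

namespace IsSuperlinear

variable {u : E → EReal} {δ B : ℝ} {N : ℝ → ℝ}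

theorem zero_mem_epigraph (hu : IsSuperlinear u δ B N) : ((0 : E), B) ∈ epigraph u :=
  hu.le 0 (norm_zero.trans_lt hu.pos)

theorem le_of_mem_epigraph (hu : IsSuperlinear u δ B N) (R : ℝ) {p : E × ℝ}
    (hp : p ∈ epigraph u) : R * ‖p.1‖ - N R ≤ p.2 :=
  EReal.coe_le_coe_iff.1 ((hu.ge R p.1).trans hp)

theorem inner_sub_le (hu : IsSuperlinear u δ B N) {z : E} {R : ℝ} (hz : ‖z‖ ≤ R) {p : E × ℝ}
    (hp : p ∈ epigraph u) : inner ℝ z p.1 - p.2 ≤ N R := by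
  have hinner := (real_inner_le_norm z p.1).trans (mul_le_mul_of_nonneg_right hz (norm_nonneg p.1))
  linarith [hu.le_of_mem_epigraph R hp]

theorem conjugate_le_iff (hu : IsSuperlinear u δ B N) {z : E} {c : ℝ} :
    conjugate u z ≤ c ↔ ∀ p ∈ epigraph u, inner ℝ z p.1 - p.2 ≤ c := by
  have : Nonempty (epigraph u) := ⟨⟨_, hu.zero_mem_epigraph⟩⟩
  have hbdd : BddAbove (range fun p : epigraph u => inner ℝ z p.1.1 - p.1.2) :=
    ⟨N ‖z‖, forall_mem_range.2 fun p => hu.inner_sub_le le_rfl p.2⟩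
  rw [conjugate, ciSup_le_iff hbdd, Subtype.forall]

theorem inner_sub_le_conjugate (hu : IsSuperlinear u δ B N) (z : E) {p : E × ℝ}
    (hp : p ∈ epigraph u) : inner ℝ z p.1 - p.2 ≤ conjugate u z :=
  hu.conjugate_le_iff.1 le_rfl p hp

theorem neg_le_conjugate (hu : IsSuperlinear u δ B N) (z : E) : -B ≤ conjugate u z := by
  simpa using hu.inner_sub_le_conjugate z hu.zero_mem_epigraph

theorem conjugate_le (hu : IsSuperlinear u δ B N) {z : E} {R : ℝ} (hz : ‖z‖ ≤ R) :
    conjugate u z ≤ N R :=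
  hu.conjugate_le_iff.2 fun _ hp => hu.inner_sub_le hz hp

theorem convexOn_conjugate (hu : IsSuperlinear u δ B N) : ConvexOn ℝ univ (conjugate u) := by
  refine ⟨convex_univ, fun z _ z' _ a b ha hb hab => hu.conjugate_le_iff.2 fun p hp => ?_⟩
  have hz := mul_le_mul_of_nonneg_left (hu.inner_sub_le_conjugate z hp) ha
  have hz' := mul_le_mul_of_nonneg_left (hu.inner_sub_le_conjugate z' hp) hb
  have hp₂ : p.2 = a * p.2 + b * p.2 := by rw [← add_mul, hab, one_mul]
  rw [inner_add_left, real_inner_smul_left, real_inner_smul_left, smul_eq_mul, smul_eq_mul]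
  linarith

theorem conjugate_le_iff_of_denseRange (hu : IsSuperlinear u δ B N) {w : ℕ → E}
    (hw : DenseRange w) {z : E} {c : ℝ} :
    conjugate u z ≤ c ↔ ∀ j, ((inner ℝ z (w j) - c : ℝ) : EReal) ≤ u (w j) := by
  refine hu.conjugate_le_iff.trans ⟨fun h j => ?_, fun h p hp => ?_⟩
  · refine le_of_not_gt fun hlt => ?_
    obtain ⟨r, hr, hrc⟩ := EReal.lt_iff_exists_real_btwn.1 hlt
    linarith [h (w j, r) hr.le, EReal.coe_lt_coe_iff.1 hrc]
  · have hle := (coe_le_of_denseRange hu.convex_epigraph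
      (interior_epigraph_nonempty hu.pos hu.le)
      (a := fun x => inner ℝ z x - c) (by fun_prop) hw h p.1).trans hp
    linarith [EReal.coe_le_coe_iff.1 hle]

theorem le_of_forall_inner_sub_conjugate_le [CompleteSpace E] (hu : IsSuperlinear u δ B N)
    {x : E} {U : ℝ} (h : ∀ z, inner ℝ z x - conjugate u z ≤ U) : u x ≤ U := by
  by_contra! hlt
  have hbelow (p : E × ℝ) (hp : p ∈ epigraph u) : -N 0 ≤ p.2 := by
    simpa using hu.le_of_mem_epigraph 0 hp
  obtain ⟨g, c, hg, hgx⟩ := exists_affine_minorant_gt hu.convex_epigraph hu.lowerSemicontinuous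
    ⟨_, hu.zero_mem_epigraph⟩ hbelow hlt
  have hinner (y : E) : inner ℝ ((InnerProductSpace.toDual ℝ E).symm g) y = g y :=
    InnerProductSpace.toDual_symm_apply
  have hc : conjugate u ((InnerProductSpace.toDual ℝ E).symm g) ≤ c :=
    hu.conjugate_le_iff.2 fun p hp => by linarith [hg p hp, hinner p.1]
  linarith [h ((InnerProductSpace.toDual ℝ E).symm g), hinner x]

theorem le_of_forall_denseRange_inner_sub_conjugate_le [CompleteSpace E]
    (hu : IsSuperlinear u δ B N) {z : ℕ → E} (hz : DenseRange z) {x : E} {U : ℝ}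
    (h : ∀ k, inner ℝ (z k) x - conjugate u (z k) ≤ U) : u x ≤ U := by
  refine hu.le_of_forall_inner_sub_conjugate_le fun v => ?_
  have hconv : Convex ℝ (epigraph fun v => (conjugate u v : EReal)) := by
    simpa [epigraph] using hu.convexOn_conjugate.convex_epigraph
  have hint : (interior (epigraph fun v => (conjugate u v : EReal))).Nonempty :=
    interior_epigraph_nonempty one_pos fun v hv =>
      EReal.coe_le_coe_iff.2 (hu.conjugate_le (le_of_lt hv))
  have hle := coe_le_of_denseRange hconv hint (a := fun v => inner ℝ v x - U) (by fun_prop) hz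
    (fun k => EReal.coe_le_coe_iff.2 (sub_le_comm.1 (h k))) v
  exact sub_le_comm.1 (EReal.coe_le_coe_iff.1 hle)

end IsSuperlinear

theorem isConvexIntegrand_conjugate {S : Type*} [MeasurableSpace S] [MeasurableSpace E]
    [BorelSpace E] [SecondCountableTopology E] {φ : S → E → EReal} {δ B : ℝ} {N : ℝ → ℝ}
    (hφ : ∀ s, IsSuperlinear (φ s) δ B N) (hm : Measurable fun x : S × E => φ x.1 x.2) :
    IsConvexIntegrand fun s => conjugate (φ s) where
  measurable := by
    let w := TopologicalSpace.denseSeq E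
    refine measurable_of_Iic fun c => ?_
    have hpre : (fun x : S × E => conjugate (φ x.1) x.2) ⁻¹' Iic c =
        ⋂ j, {x | ((inner ℝ x.2 (w j) - c : ℝ) : EReal) ≤ φ x.1 (w j)} := by
      ext x
      rw [mem_iInter]
      exact (hφ x.1).conjugate_le_iff_of_denseRange (TopologicalSpace.denseRange_denseSeq E)
    rw [hpre]
    exact .iInter fun j => measurableSet_le
      (measurable_snd.inner_const.sub_const c).coe_real_ereal
      (hm.comp (measurable_fst.prodMk measurable_const))
  convexOn s := (hφ s).convexOn_conjugate
  bddBelow := ⟨B, fun s z => (hφ s).neg_le_conjugate z⟩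
  bddAbove R := ⟨N R, fun s _ hz => (hφ s).conjugate_le hz⟩

end

section

section Growth

theorem exists_mul_le_mul_rpow_add {c P : ℝ} (hc : 0 < c) (hP : 1 < P) (R : ℝ) :
    ∃ K, ∀ x, 0 ≤ x → R * x ≤ c * x ^ P + K := by
  have hP₀ : 0 < P := one_pos.trans hP
  let k : ℝ := (c * P) ^ P⁻¹
  have hk : 0 < k := by positivity
  refine ⟨|R / k| ^ P.conjExponent / P.conjExponent, fun x hx => ?_⟩
  calc R * x = (k * x) * (R / k) := by field_simp
    _ ≤ |k * x| ^ P / P + |R / k| ^ P.conjExponent / P.conjExponent :=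
        Real.young_inequality _ _ (.conjExponent hP)
    _ = c * x ^ P + |R / k| ^ P.conjExponent / P.conjExponent := by
        rw [abs_of_nonneg (by positivity), Real.mul_rpow hk.le hx,
          Real.rpow_inv_rpow (by positivity) hP₀.ne', mul_right_comm,
          mul_div_cancel_right₀ _ hP₀.ne']

variable {E : Type*} [NormedAddCommGroup E] [InnerProductSpace ℝ E] {u : E → EReal} {c C A : ℝ}

theorem isSuperlinear_of_chi (hu : Convex ℝ (epigraph u)) (hlsc : LowerSemicontinuous u)
    (hc : 0 < c) (hC : 0 < C) (hge : ∀ x, chi (c * ‖x‖) - (A : EReal) ≤ u x)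
    (hle : ∀ x, u x ≤ chi (C * ‖x‖) + (A : EReal)) :
    IsSuperlinear u C⁻¹ A fun R => |R| / c + A where
  convex_epigraph := hu
  lowerSemicontinuous := hlsc
  pos := inv_pos.2 hC
  le x hx := by
    have hx₁ : C * ‖x‖ ≤ 1 := ((lt_inv_mul_iff₀ hC).1 (by rwa [mul_one])).le
    simpa only [chi, if_pos hx₁, zero_add] using hle x
  ge R x := by
    refine le_trans ?_ (hge x)
    rcases le_or_gt (c * ‖x‖) 1 with hx | hx
    · have hRx : R * ‖x‖ ≤ |R| / c := by
        rw [le_div_iff₀ hc, mul_assoc, mul_comm ‖x‖]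
        exact (mul_le_mul_of_nonneg_right (le_abs_self R) (by positivity)).trans
          (mul_le_of_le_one_right (abs_nonneg R) hx)
      rw [chi, if_pos hx, zero_sub, ← EReal.coe_neg, EReal.coe_le_coe_iff]
      linarith
    · rw [chi, if_neg hx.not_ge, EReal.top_sub_coe]
      exact le_top

theorem isSuperlinear_of_rpow {P : ℝ} {K : ℝ → ℝ} (hu : Convex ℝ (epigraph u))
    (hlsc : LowerSemicontinuous u) (hP : 0 ≤ P) (hC : 0 ≤ C)
    (hK : ∀ R x, 0 ≤ x → R * x ≤ c * x ^ P + K R)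
    (hge : ∀ x, ((c * ‖x‖ ^ P - A : ℝ) : EReal) ≤ u x)
    (hle : ∀ x, u x ≤ ((C * ‖x‖ ^ P + A : ℝ) : EReal)) :
    IsSuperlinear u 1 (C + A) fun R => K R + A where
  convex_epigraph := hu
  lowerSemicontinuous := hlsc
  pos := one_pos
  le x hx := by
    refine (hle x).trans (EReal.coe_le_coe_iff.2 (add_le_add_left ?_ A))
    exact mul_le_of_le_one_right hC (Real.rpow_le_one (norm_nonneg x) hx.le hP)
  ge R x := by
    refine le_trans (EReal.coe_le_coe_iff.2 ?_) (hge x)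
    linarith [hK R ‖x‖ (norm_nonneg x)]

end Growth

variable {n : ℕ} {p : ℝ≥0∞}

theorem IsConvexFun.convex_epigraph {u : EuclideanSpace ℂ (Fin n) → EReal} (hu : IsConvexFun u) :
    Convex ℝ (epigraph u) :=
  convex_epigraph_of_convexOn_toReal hu.ne_bot hu.convexOn

theorem IsConvexFun.lowerSemicontinuous {u : EuclideanSpace ℂ (Fin n) → EReal}
    (hu : IsConvexFun u) (hfin : ∀ z, u z < ⊤) : LowerSemicontinuous u := by
  have hconv : ConvexOn ℝ univ fun z => (u z).toReal := by
    simpa only [hfin, ofPred_true] using hu.convexOn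
  have hcont : Continuous fun z => (u z).toReal := by
    simpa only [interior_univ, continuousOn_univ] using hconv.continuousOn_interior
  have hcoe : u = fun z => ((u z).toReal : EReal) :=
    funext fun z => (EReal.coe_toReal (hfin z).ne (hu.ne_bot z)).symm
  rw [hcoe]
  exact (continuous_coe_real_ereal.comp hcont).lowerSemicontinuous

namespace UniformGrowth

variable {φ : Circle → EuclideanSpace ℂ (Fin n) → EReal}

theorem exists_isSuperlinear (hφ : UniformGrowth p φ) (hp : 1 < p)
    (hconv : ∀ s, IsConvexFun (φ s)) :
    ∃ (δ B : ℝ) (N : ℝ → ℝ), ∀ s, IsSuperlinear (φ s) δ B N := by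
  obtain ⟨⟨c, C, A, hc, hC, -, h⟩, hlsc⟩ := hφ
  by_cases hptop : p = ∞
  · simp only [hptop, if_true] at h
    exact ⟨_, _, _, fun s => isSuperlinear_of_chi (hconv s).convex_epigraph (hlsc hptop s) hc hC
      (fun z => (h s z).1) fun z => (h s z).2⟩
  · simp only [hptop, if_false] at h
    have hP : 1 < p.toReal := by
      simpa only [ENNReal.toReal_one] using ENNReal.toReal_strict_mono hptop hp
    choose K hK using exists_mul_le_mul_rpow_add hc hP
    exact ⟨_, _, _, fun s => isSuperlinear_of_rpow (hconv s).convex_epigraph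
      ((hconv s).lowerSemicontinuous fun z => (h s z).2.trans_lt (EReal.coe_lt_top _))
      (zero_le_one.trans hP.le) hC.le hK (fun z => (h s z).1) fun z => (h s z).2⟩

theorem memLp (hφ : UniformGrowth p φ) (hp : p ≠ 0) {μ : Measure Circle} [IsFiniteMeasure μ]
    {F : Circle → EuclideanSpace ℂ (Fin n)} (hF : AEStronglyMeasurable F μ) {U : Circle → ℝ}
    (hU : Integrable U μ) (hFU : ∀ᵐ s ∂μ, φ s (F s) ≤ (U s : EReal)) : MemLp F p μ := by
  obtain ⟨⟨c, C, A, hc, -, -, h⟩, -⟩ := hφ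
  by_cases hptop : p = ∞
  · simp only [hptop, if_true] at h ⊢
    refine memLp_top_of_bound hF (1 / c) (hFU.mono fun s hs => ?_)
    rw [le_div_iff₀' hc]
    by_contra! hlarge
    have htop := (h s (F s)).1.trans hs
    rw [chi, if_neg hlarge.not_ge, EReal.top_sub_coe] at htop
    exact EReal.coe_ne_top _ (top_le_iff.1 htop)
  · simp only [hptop, if_false] at h
    rw [← integrable_norm_rpow_iff hF hp hptop]
    refine ((hU.add (integrable_const A)).const_mul c⁻¹).mono'
      (hF.norm.aemeasurable.pow_const _).aestronglyMeasurable (hFU.mono fun s hs => ?_)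
    rw [Real.norm_of_nonneg (by positivity), Pi.add_apply, le_inv_mul_iff₀ hc]
    exact sub_le_iff_le_add.1 (EReal.coe_le_coe_iff.1 ((h s (F s)).1.trans hs))

end UniformGrowth

end

section CompactDomain

variable {X E : Type*} [TopologicalSpace X] [CompactSpace X] [MeasurableSpace X]
  [NormedAddCommGroup E]

theorem memLp_of_continuous [OpensMeasurableSpace X] {μ : Measure X} [IsFiniteMeasureOnCompacts μ]
    {h : X → E} (hh : Continuous h) (q : ℝ≥0∞) : MemLp h q μ :=
  hh.memLp_of_hasCompactSupport (.of_compactSpace h)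

theorem integrable_of_continuous [OpensMeasurableSpace X] {μ : Measure X}
    [IsFiniteMeasureOnCompacts μ] {h : X → E} (hh : Continuous h) : Integrable h μ :=
  memLp_one_iff_integrable.1 (memLp_of_continuous hh 1)

theorem integrable_continuous_smul [OpensMeasurableSpace X] {𝕜 : Type*} [RCLike 𝕜]
    [NormedSpace 𝕜 E] {μ : Measure X} {k : X → 𝕜} (hk : Continuous k) {h : X → E}
    (hh : Integrable h μ) : Integrable (fun x => k x • h x) μ := by
  obtain ⟨C, hC⟩ := isCompact_univ.exists_bound_of_continuousOn hk.continuousOn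
  exact hh.bdd_smul C hk.aestronglyMeasurable (ae_of_all _ fun x => hC x (mem_univ x))

end CompactDomain

theorem exists_norm_sub_le_add_mul_dist_sq {X E : Type*} [PseudoMetricSpace X] [CompactSpace X]
    [SeminormedAddCommGroup E] {h : X → E} (hh : Continuous h) {ε : ℝ} (hε : 0 < ε) :
    ∃ K, ∀ x y, ‖h x - h y‖ ≤ ε + K * dist x y ^ 2 := by
  obtain ⟨δ, hδ, hδh⟩ := Metric.uniformContinuous_iff.1
    (CompactSpace.uniformContinuous_of_continuous hh) ε hε
  obtain ⟨M, hM⟩ := isCompact_univ.exists_bound_of_continuousOn hh.continuousOn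
  have hK : 0 ≤ 2 * |M| / δ ^ 2 := by positivity
  refine ⟨2 * |M| / δ ^ 2, fun x y => ?_⟩
  rcases lt_or_ge (dist x y) δ with hd | hd
  · have hclose : ‖h x - h y‖ < ε := dist_eq_norm (h x) (h y) ▸ hδh hd
    nlinarith [mul_nonneg hK (sq_nonneg (dist x y))]
  · have hfar : 2 * |M| ≤ 2 * |M| / δ ^ 2 * dist x y ^ 2 := by
      calc 2 * |M| = 2 * |M| / δ ^ 2 * δ ^ 2 := by field_simp
        _ ≤ _ := by gcongr
    linarith [norm_sub_le (h x) (h y), hM x (mem_univ x), hM y (mem_univ y), le_abs_self M]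

section ArcMeasure

theorem arcMeasure_eq_map : arcMeasure = Measure.map Circle.exp
    (ENNReal.ofReal (2 * Real.pi)⁻¹ • volume.restrict (Ioc 0 (2 * Real.pi))) :=
  (Measure.map_smul _ _ _).symm

theorem measurable_circleExp : Measurable (Circle.exp : ℝ → Circle) :=
  Circle.exp.continuous.measurable

instance : IsProbabilityMeasure arcMeasure where
  measure_univ := by
    rw [arcMeasure_eq_map, Measure.map_apply measurable_circleExp .univ]
    simp only [preimage_univ, Measure.smul_apply, Measure.restrict_apply_univ, Real.volume_Ioc,
      sub_zero, smul_eq_mul]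
    rw [← ENNReal.ofReal_mul (by positivity), inv_mul_cancel₀ (by positivity), ENNReal.ofReal_one]

theorem circleMap_zero_one (θ : ℝ) : circleMap 0 1 θ = (Circle.exp θ : ℂ) := by
  simp only [circleMap_zero, Complex.ofReal_one, one_mul, Circle.coe_exp]

variable {E : Type*} [NormedAddCommGroup E] {h : Circle → E} {g : ℂ → E}

theorem integral_arcMeasure [NormedSpace ℝ E] (hh : AEStronglyMeasurable h arcMeasure)
    (hg : ∀ s : Circle, g s = h s) : ∫ s, h s ∂arcMeasure = Real.circleAverage g 0 1 := by
  rw [arcMeasure_eq_map] at hh ⊢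
  rw [integral_map measurable_circleExp.aemeasurable hh, integral_smul_measure,
    Real.circleAverage_def, intervalIntegral.integral_of_le (by positivity),
    ENNReal.toReal_ofReal (by positivity)]
  simp only [circleMap_zero_one, hg]

theorem circleIntegrable_of_integrable_arcMeasure (hh : Integrable h arcMeasure)
    (hg : ∀ s : Circle, g s = h s) : CircleIntegrable g 0 1 := by
  have hmeas := hh.aestronglyMeasurable
  rw [arcMeasure_eq_map] at hh hmeas
  rw [integrable_map_measure hmeas measurable_circleExp.aemeasurable,
    integrable_smul_measure (by simpa using Real.pi_pos) ENNReal.ofReal_ne_top] at hh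
  rw [CircleIntegrable, intervalIntegrable_iff, uIoc_of_le (by positivity)]
  simp only [circleMap_zero_one, hg]
  exact hh

theorem continuous_comp_coe_circle [NormedSpace ℂ E] (hg : DiffContOnCl ℂ g (ball 0 1)) :
    Continuous fun s : Circle => g s := by
  have hcont := hg.continuousOn
  rw [closure_ball _ one_ne_zero] at hcont
  exact hcont.comp_continuous continuous_subtype_val fun s => by simp [Circle.norm_coe]

end ArcMeasure

/-- The Poisson kernel of the unit disc, as a function of a point of the disc and a point of the
circle; it is the density appearing in `poisson`. -/
noncomputable def kernel (t : ℂ) (s : Circle) : ℝ := (1 - ‖t‖ ^ 2) / ‖(s : ℂ) - t‖ ^ 2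

section Kernel

variable {t : ℂ}

theorem norm_lt_one_of_mem_ball (ht : t ∈ ball (0 : ℂ) 1) : ‖t‖ < 1 :=
  mem_ball_zero_iff.1 ht

theorem sub_ne_zero_of_mem_ball (ht : t ∈ ball (0 : ℂ) 1) (s : Circle) : (s : ℂ) - t ≠ 0 := by
  rw [sub_ne_zero]
  rintro rfl
  simp [Circle.norm_coe] at ht

theorem one_sub_conj_mul_ne_zero (ht : t ∈ ball (0 : ℂ) 1) {z : ℂ} (hz : ‖z‖ ≤ 1) :
    1 - starRingEnd ℂ t * z ≠ 0 := by
  rw [sub_ne_zero]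
  intro h
  have hnorm := congrArg norm h
  rw [norm_one, norm_mul, RCLike.norm_conj] at hnorm
  nlinarith [norm_nonneg z, norm_nonneg t, norm_lt_one_of_mem_ball ht]

theorem ofReal_mul_circle_mem_ball {r : ℝ} (hr : r ∈ Ioo (0 : ℝ) 1) (s : Circle) :
    (r : ℂ) * s ∈ ball (0 : ℂ) 1 := by
  simp [abs_of_pos hr.1, hr.2, Circle.norm_coe]

theorem kernel_eq_re_herglotz (t : ℂ) (s : Circle) :
    kernel t s = (herglotzRieszKernel 0 t s).re := by
  have h := congrFun (poissonKernel_eq_re_herglotzRieszKernel (c := 0) (w := t)) s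
  rw [Function.comp_apply] at h
  rw [← h]
  simp [poissonKernel_def, kernel, Circle.norm_coe]

theorem kernel_le (ht : t ∈ ball (0 : ℂ) 1) (s : Circle) :
    kernel t s ≤ (1 + ‖t‖) / (1 - ‖t‖) := by
  have h := re_herglotzRieszKernel_le (z := s) (by simp [Circle.norm_coe]) ht
  rwa [← herglotzRieszKernel_def, ← kernel_eq_re_herglotz, sub_zero] at h

theorem le_kernel (ht : t ∈ ball (0 : ℂ) 1) (s : Circle) :
    (1 - ‖t‖) / (1 + ‖t‖) ≤ kernel t s := by
  have h := le_re_herglotzRieszKernel (z := s) (by simp [Circle.norm_coe]) ht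
  rwa [← herglotzRieszKernel_def, ← kernel_eq_re_herglotz, sub_zero] at h

theorem kernel_pos (ht : t ∈ ball (0 : ℂ) 1) (s : Circle) : 0 < kernel t s := by
  refine lt_of_lt_of_le ?_ (le_kernel ht s)
  have := norm_lt_one_of_mem_ball ht
  exact div_pos (by linarith) (by positivity)

theorem continuous_kernel (ht : t ∈ ball (0 : ℂ) 1) : Continuous (kernel t) := by
  unfold kernel
  exact continuous_const.div (by fun_prop) fun s =>
    pow_ne_zero _ (norm_ne_zero_iff.2 (sub_ne_zero_of_mem_ball ht s))

theorem measurable_kernel_dilate (r : ℝ) :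
    Measurable fun x : Circle × Circle => kernel (r * x.1) x.2 := by
  unfold kernel
  exact (Continuous.measurable (by fun_prop)).div (Continuous.measurable (by fun_prop))

theorem kernel_ofReal_mul_comm (r : ℝ) (s x : Circle) : kernel (r * s) x = kernel (r * x) s := by
  have hnorm : ‖(r : ℂ) * s‖ = ‖(r : ℂ) * x‖ := by simp [Circle.norm_coe]
  have hdist : ‖(x : ℂ) - r * s‖ ^ 2 = ‖(s : ℂ) - r * x‖ ^ 2 := by
    simp only [← Complex.normSq_eq_norm_sq, Complex.normSq_sub]
    simp only [Complex.normSq_eq_norm_sq, Circle.norm_coe, map_mul, Complex.conj_ofReal,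
      Complex.mul_re, Complex.mul_im, Complex.ofReal_re, Complex.ofReal_im, Complex.conj_re,
      Complex.conj_im]
    ring
  rw [kernel, kernel, hnorm, hdist]

end Kernel

section Poisson

variable {E : Type*} [NormedAddCommGroup E] [NormedSpace ℝ E] {h g : Circle → E} {t : ℂ}

theorem poisson_def (h : Circle → E) (t : ℂ) :
    poisson h t = ∫ s, kernel t s • h s ∂arcMeasure := rfl

theorem integrable_kernel_smul (ht : t ∈ ball (0 : ℂ) 1) (hh : Integrable h arcMeasure) :
    Integrable (fun s => kernel t s • h s) arcMeasure :=
  integrable_continuous_smul (continuous_kernel ht) hh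

theorem poisson_add (ht : t ∈ ball (0 : ℂ) 1) (hh : Integrable h arcMeasure)
    (hg : Integrable g arcMeasure) :
    poisson (fun s => h s + g s) t = poisson h t + poisson g t := by
  simp only [poisson_def, smul_add]
  exact integral_add (integrable_kernel_smul ht hh) (integrable_kernel_smul ht hg)

theorem poisson_sub (ht : t ∈ ball (0 : ℂ) 1) (hh : Integrable h arcMeasure)
    (hg : Integrable g arcMeasure) :
    poisson (fun s => h s - g s) t = poisson h t - poisson g t := by
  simp only [poisson_def, smul_sub]
  exact integral_sub (integrable_kernel_smul ht hh) (integrable_kernel_smul ht hg)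

theorem poisson_const_mul (c : ℝ) (h : Circle → ℝ) (t : ℂ) :
    poisson (fun s => c * h s) t = c * poisson h t := by
  simp only [poisson_def, smul_eq_mul, mul_left_comm _ c, integral_const_mul]

theorem poisson_mono_ae {h g : Circle → ℝ} (ht : t ∈ ball (0 : ℂ) 1)
    (hh : Integrable h arcMeasure) (hg : Integrable g arcMeasure)
    (hhg : ∀ᵐ s ∂arcMeasure, h s ≤ g s) : poisson h t ≤ poisson g t :=
  integral_mono_ae (integrable_kernel_smul ht hh) (integrable_kernel_smul ht hg)
    (hhg.mono fun s hs => mul_le_mul_of_nonneg_left hs (kernel_pos ht s).le)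

theorem poisson_nonneg {h : Circle → ℝ} (ht : t ∈ ball (0 : ℂ) 1)
    (hh : ∀ᵐ s ∂arcMeasure, 0 ≤ h s) : 0 ≤ poisson h t :=
  integral_nonneg_of_ae (hh.mono fun s hs => mul_nonneg (kernel_pos ht s).le hs)

theorem poisson_le_mul_poisson {h : Circle → ℝ} {t₀ : ℂ} (ht : t ∈ ball (0 : ℂ) 1)
    (ht₀ : t₀ ∈ ball (0 : ℂ) 1) (hh : Integrable h arcMeasure)
    (h0 : ∀ᵐ s ∂arcMeasure, 0 ≤ h s) :
    poisson h t ≤ (1 + ‖t‖) / (1 - ‖t‖) / ((1 - ‖t₀‖) / (1 + ‖t₀‖)) * poisson h t₀ := by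
  have htn := norm_lt_one_of_mem_ball ht
  have ht₀n := norm_lt_one_of_mem_ball ht₀
  have hpos : 0 < (1 - ‖t₀‖) / (1 + ‖t₀‖) := div_pos (by linarith) (by positivity)
  rw [← poisson_const_mul, poisson_def, poisson_def]
  refine integral_mono_ae (integrable_kernel_smul ht hh)
    (integrable_kernel_smul ht₀ (hh.const_mul _)) (h0.mono fun s hs => ?_)
  simp only [smul_eq_mul, ← mul_assoc]
  refine mul_le_mul_of_nonneg_right ?_ hs
  rw [mul_div_assoc', le_div_iff₀ hpos, mul_comm (kernel t₀ s)]
  exact mul_le_mul (kernel_le ht s) (le_kernel ht₀ s) hpos.le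
    (div_nonneg (by positivity) (by linarith))

theorem poisson_of_diffContOnCl {E : Type*} [NormedAddCommGroup E] [NormedSpace ℂ E]
    [CompleteSpace E] {G : ℂ → E} (hG : DiffContOnCl ℂ G (ball 0 1)) (ht : t ∈ ball (0 : ℂ) 1) :
    poisson (fun s => G s) t = G t := by
  rw [← hG.circleAverage_poissonKernel_smul ht, poisson_def]
  refine integral_arcMeasure (integrable_kernel_smul ht
    (integrable_of_continuous (continuous_comp_coe_circle hG))).aestronglyMeasurable fun s => ?_
  simp [poissonKernel_def, kernel, Circle.norm_coe]

variable [CompleteSpace E]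

theorem map_poisson {F : Type*} [NormedAddCommGroup F] [NormedSpace ℝ F] [CompleteSpace F]
    (L : E →L[ℝ] F) (ht : t ∈ ball (0 : ℂ) 1) (hh : Integrable h arcMeasure) :
    L (poisson h t) = poisson (fun s => L (h s)) t := by
  simp only [poisson_def, ← map_smul]
  exact (L.integral_comp_comm (integrable_kernel_smul ht hh)).symm

theorem integral_kernel (ht : t ∈ ball (0 : ℂ) 1) : ∫ s, kernel t s ∂arcMeasure = 1 := by
  have h := map_poisson Complex.reCLM ht (integrable_const (1 : ℂ))
  rw [poisson_of_diffContOnCl (G := fun _ => (1 : ℂ)) diffContOnCl_const ht] at h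
  simpa [poisson_def] using h.symm

theorem poisson_const (ht : t ∈ ball (0 : ℂ) 1) (v : E) : poisson (fun _ => v) t = v := by
  rw [poisson_def, integral_smul_const, integral_kernel ht, one_smul]

theorem norm_poisson_sub_le (ht : t ∈ ball (0 : ℂ) 1) (hh : Integrable h arcMeasure) (v : E) :
    ‖poisson h t - v‖ ≤ poisson (fun s => ‖h s - v‖) t := by
  conv_lhs => rw [← poisson_const ht v, ← poisson_sub ht hh (integrable_const v), poisson_def]
  refine (norm_integral_le_integral_norm _).trans_eq (integral_congr_ae (ae_of_all _ fun s => ?_))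
  simp only [norm_smul, Real.norm_of_nonneg (kernel_pos ht s).le]
  rfl

theorem poisson_dist_sq {r : ℝ} (hr : r ∈ Ioo (0 : ℝ) 1) (s : Circle) :
    poisson (fun x => dist x s ^ 2) (r * s) = 2 - 2 * r := by
  have ht := ofReal_mul_circle_mem_ball hr s
  have hi : Integrable (fun x : Circle => (x : ℂ)) arcMeasure :=
    integrable_of_continuous (by fun_prop)
  let L : ℂ →L[ℝ] ℝ := (2 : ℝ) • innerSL ℝ (s : ℂ)
  have hdist (x : Circle) : dist x s ^ 2 = 2 - L x := by
    change dist (x : ℂ) s ^ 2 = 2 - 2 * inner ℝ (s : ℂ) x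
    rw [dist_eq_norm, norm_sub_sq_real, real_inner_comm, Circle.norm_coe, Circle.norm_coe]
    ring
  have hL : L (r * s) = 2 * r := by
    change 2 * inner ℝ (s : ℂ) (r * s) = 2 * r
    rw [← Complex.real_smul, real_inner_smul_right, real_inner_self_eq_norm_sq, Circle.norm_coe]
    ring
  simp only [hdist]
  rw [poisson_sub ht (integrable_const _) (L.integrable_comp hi), poisson_const ht,
    ← map_poisson L ht hi,
    poisson_of_diffContOnCl (G := fun z => z) differentiable_id.diffContOnCl ht]
  exact congrArg _ hL

theorem tendstoUniformly_poisson_dilate (hh : Continuous h) :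
    TendstoUniformly (fun (r : ℝ) (s : Circle) => poisson h (r * s)) h (𝓝[<] 1) := by
  rw [Metric.tendstoUniformly_iff]
  intro ε hε
  obtain ⟨K, hbound⟩ := exists_norm_sub_le_add_mul_dist_sq hh (half_pos hε)
  have hsmall : ∀ᶠ r : ℝ in 𝓝[<] 1, K * (2 - 2 * r) < ε / 2 := by
    refine nhdsWithin_le_nhds (ContinuousAt.eventually_lt (by fun_prop) continuousAt_const ?_)
    simpa using hε
  filter_upwards [hsmall, Ioo_mem_nhdsLT zero_lt_one] with r hrK hr s
  have ht := ofReal_mul_circle_mem_ball hr s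
  have hint : Integrable (fun x => dist x s ^ 2) arcMeasure :=
    integrable_of_continuous (by fun_prop)
  rw [dist_comm, dist_eq_norm]
  calc ‖poisson h (r * s) - h s‖ ≤ poisson (fun x => ‖h x - h s‖) (r * s) :=
        norm_poisson_sub_le ht (integrable_of_continuous hh) _
    _ ≤ poisson (fun x => ε / 2 + K * dist x s ^ 2) (r * s) :=
        poisson_mono_ae ht (integrable_of_continuous (by fun_prop))
          ((integrable_const _).add (hint.const_mul K)) (ae_of_all _ fun x => hbound x s)
    _ = ε / 2 + K * (2 - 2 * r) := by
        rw [poisson_add ht (integrable_const _) (hint.const_mul K), poisson_const ht,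
          poisson_const_mul, poisson_dist_sq hr]
    _ < ε := by linarith

end Poisson

/-- The harmonic measure of the unit disc at the point `t`: integrating against it evaluates the
Poisson integral at `t`. -/
noncomputable def harmonicMeasure (t : ℂ) : Measure Circle :=
  arcMeasure.withDensity fun s => ENNReal.ofReal (kernel t s)

section HarmonicMeasure

variable {E : Type*} [NormedAddCommGroup E] [NormedSpace ℝ E] {h : Circle → E} {t : ℂ}

theorem measurable_ofReal_kernel (ht : t ∈ ball (0 : ℂ) 1) :
    Measurable fun s => ENNReal.ofReal (kernel t s) :=
  (continuous_kernel ht).measurable.ennreal_ofReal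

theorem lintegral_kernel (ht : t ∈ ball (0 : ℂ) 1) :
    ∫⁻ s, ENNReal.ofReal (kernel t s) ∂arcMeasure = 1 := by
  rw [← ofReal_integral_eq_lintegral_ofReal (integrable_of_continuous (continuous_kernel ht))
    (ae_of_all _ fun s => (kernel_pos ht s).le), integral_kernel ht, ENNReal.ofReal_one]

theorem isProbabilityMeasure_harmonicMeasure (ht : t ∈ ball (0 : ℂ) 1) :
    IsProbabilityMeasure (harmonicMeasure t) :=
  ⟨by rw [harmonicMeasure, withDensity_apply _ .univ, Measure.restrict_univ, lintegral_kernel ht]⟩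

theorem lintegral_harmonicMeasure (ht : t ∈ ball (0 : ℂ) 1) {u : Circle → ℝ≥0∞}
    (hu : AEMeasurable u arcMeasure) :
    ∫⁻ s, u s ∂harmonicMeasure t = ∫⁻ s, ENNReal.ofReal (kernel t s) * u s ∂arcMeasure :=
  lintegral_withDensity_eq_lintegral_mul₀ (measurable_ofReal_kernel ht).aemeasurable hu

theorem integral_harmonicMeasure (ht : t ∈ ball (0 : ℂ) 1) (h : Circle → E) :
    ∫ s, h s ∂harmonicMeasure t = poisson h t := by
  rw [harmonicMeasure, integral_withDensity_eq_integral_toReal_smul (measurable_ofReal_kernel ht)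
    (ae_of_all _ fun s => ENNReal.ofReal_lt_top), poisson_def]
  simp only [ENNReal.toReal_ofReal (kernel_pos ht _).le]

theorem integrable_harmonicMeasure_iff (ht : t ∈ ball (0 : ℂ) 1) :
    Integrable h (harmonicMeasure t) ↔ Integrable h arcMeasure := by
  rw [harmonicMeasure, integrable_withDensity_iff_integrable_smul' (measurable_ofReal_kernel ht)
    (ae_of_all _ fun s => ENNReal.ofReal_lt_top)]
  simp only [ENNReal.toReal_ofReal (kernel_pos ht _).le]
  refine ⟨fun hi => ?_, integrable_kernel_smul ht⟩
  have hinv : Continuous fun s => (kernel t s)⁻¹ :=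
    (continuous_kernel ht).inv₀ fun s => (kernel_pos ht s).ne'
  refine (integrable_continuous_smul hinv hi).congr (ae_of_all _ fun s => ?_)
  simp only [inv_smul_smul₀ (kernel_pos ht s).ne']

theorem ae_harmonicMeasure_iff (ht : t ∈ ball (0 : ℂ) 1) {P : Circle → Prop} :
    (∀ᵐ s ∂harmonicMeasure t, P s) ↔ ∀ᵐ s ∂arcMeasure, P s := by
  rw [harmonicMeasure, ae_withDensity_iff (measurable_ofReal_kernel ht)]
  simp [kernel_pos ht]

theorem enorm_poisson_le_eLpNorm (ht : t ∈ ball (0 : ℂ) 1) {q : ℝ≥0∞} (hq : 1 ≤ q)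
    (hh : AEStronglyMeasurable h arcMeasure) :
    ‖poisson h t‖ₑ ≤ eLpNorm h q (harmonicMeasure t) := by
  have := isProbabilityMeasure_harmonicMeasure ht
  rw [← integral_harmonicMeasure ht]
  refine (enorm_integral_le_lintegral_enorm h).trans ?_
  rw [← eLpNorm_one_eq_lintegral_enorm]
  exact eLpNorm_le_eLpNorm_of_exponent_le hq (hh.mono_ac (withDensity_absolutelyContinuous _ _))

theorem enorm_poisson_rpow_le (ht : t ∈ ball (0 : ℂ) 1) {q : ℝ≥0∞} (hq : 1 ≤ q) (hq' : q ≠ ∞)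
    (hh : AEStronglyMeasurable h arcMeasure) :
    ‖poisson h t‖ₑ ^ q.toReal ≤
      ∫⁻ s, ENNReal.ofReal (kernel t s) * ‖h s‖ₑ ^ q.toReal ∂arcMeasure := by
  have hq0 : q ≠ 0 := (zero_lt_one.trans_le hq).ne'
  rw [← lintegral_harmonicMeasure ht (hh.enorm.pow_const _),
    ← ENNReal.le_rpow_inv_iff (ENNReal.toReal_pos hq0 hq'), ← one_div,
    ← eLpNorm_eq_lintegral_rpow_enorm_toReal hq0 hq']
  exact enorm_poisson_le_eLpNorm ht hq hh

end HarmonicMeasure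

section Dilates

variable {E : Type*} [NormedAddCommGroup E] [NormedSpace ℝ E] {q : ℝ≥0∞} {h : Circle → E} {r : ℝ}

theorem aestronglyMeasurable_poisson_dilate (hh : AEStronglyMeasurable h arcMeasure) (r : ℝ) :
    AEStronglyMeasurable (fun s : Circle => poisson h (r * s)) arcMeasure :=
  AEStronglyMeasurable.integral_prod_right'
    (f := fun x : Circle × Circle => kernel (r * x.1) x.2 • h x.2)
    ((measurable_kernel_dilate r).aestronglyMeasurable.smul hh.comp_snd)

theorem eLpNorm_poisson_dilate_le (hr : r ∈ Ioo (0 : ℝ) 1) (hq : 1 ≤ q) (hq' : q ≠ ∞)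
    (hh : AEStronglyMeasurable h arcMeasure) :
    eLpNorm (fun s : Circle => poisson h (r * s)) q arcMeasure ≤ eLpNorm h q arcMeasure := by
  have hq0 : q ≠ 0 := (zero_lt_one.trans_le hq).ne'
  rw [eLpNorm_eq_lintegral_rpow_enorm_toReal hq0 hq',
    eLpNorm_eq_lintegral_rpow_enorm_toReal hq0 hq']
  refine ENNReal.rpow_le_rpow ?_ (by positivity)
  have hm : AEMeasurable (Function.uncurry fun s x : Circle =>
      ENNReal.ofReal (kernel (r * s) x) * ‖h x‖ₑ ^ q.toReal) (arcMeasure.prod arcMeasure) :=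
    (measurable_kernel_dilate r).ennreal_ofReal.aemeasurable.mul
      (hh.comp_snd.enorm.pow_const _)
  calc ∫⁻ s : Circle, ‖poisson h (r * s)‖ₑ ^ q.toReal ∂arcMeasure
      ≤ ∫⁻ s : Circle, ∫⁻ x, ENNReal.ofReal (kernel (r * s) x) * ‖h x‖ₑ ^ q.toReal
          ∂arcMeasure ∂arcMeasure :=
        lintegral_mono fun s =>
          enorm_poisson_rpow_le (ofReal_mul_circle_mem_ball hr s) hq hq' hh
    _ = ∫⁻ x, ∫⁻ s : Circle, ENNReal.ofReal (kernel (r * s) x) * ‖h x‖ₑ ^ q.toReal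
          ∂arcMeasure ∂arcMeasure := lintegral_lintegral_swap hm
    _ = ∫⁻ x, ‖h x‖ₑ ^ q.toReal ∂arcMeasure := by
        refine lintegral_congr fun x => ?_
        have hx := ofReal_mul_circle_mem_ball hr x
        simp_rw [kernel_ofReal_mul_comm r _ x]
        rw [lintegral_mul_const _ (measurable_ofReal_kernel hx), lintegral_kernel hx, one_mul]

variable [CompleteSpace E]

theorem eventually_eLpNorm_poisson_dilate_sub_le (hh : Continuous h) {ε : ℝ≥0∞} (hε : 0 < ε) :
    ∀ᶠ r : ℝ in 𝓝[<] 1,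
      eLpNorm (fun s : Circle => poisson h (r * s) - h s) q arcMeasure ≤ ε := by
  obtain ⟨η, hη0, hη⟩ := ENNReal.lt_iff_exists_nnreal_btwn.1 hε
  filter_upwards [Metric.tendstoUniformly_iff.1 (tendstoUniformly_poisson_dilate hh) η
    (by exact_mod_cast hη0)] with r hr
  have hbound (s : Circle) : ‖poisson h (r * s) - h s‖ ≤ η := by
    rw [← dist_eq_norm, dist_comm]
    exact (hr s).le
  exact (eLpNorm_le_of_ae_bound (ae_of_all _ hbound)).trans (by simpa using hη.le)

theorem tendsto_eLpNorm_poisson_dilate_sub (hq : 1 ≤ q) (hq' : q ≠ ∞)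
    (hh : MemLp h q arcMeasure) :
    Tendsto (fun r : ℝ => eLpNorm ((fun s : Circle => poisson h (r * s)) - h) q arcMeasure)
      (𝓝[<] 1) (𝓝 0) := by
  rw [ENNReal.tendsto_nhds_zero]
  intro ε hε
  have hε3 : 0 < ε / 3 := ENNReal.div_pos hε.ne' (by simp)
  obtain ⟨g, hg, -⟩ := hh.exists_boundedContinuous_eLpNorm_sub_le hq' hε3.ne'
  filter_upwards [eventually_eLpNorm_poisson_dilate_sub_le (q := q) g.continuous hε3,
    Ioo_mem_nhdsLT zero_lt_one] with r hrg hr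
  have hhi : Integrable h arcMeasure := hh.integrable hq
  have hgi : Integrable g arcMeasure := integrable_of_continuous g.continuous
  have hsplit : (fun s : Circle => poisson h (r * s)) - h =
      ((fun s : Circle => poisson (fun x => h x - g x) (r * s)) +
        fun s : Circle => poisson g (r * s) - g s) - (h - ⇑g) := by
    ext s
    simp only [Pi.sub_apply, Pi.add_apply]
    rw [poisson_sub (ofReal_mul_circle_mem_ball hr s) hhi hgi]
    abel
  have hm₁ := aestronglyMeasurable_poisson_dilate (hhi.sub hgi).aestronglyMeasurable r
  have hm₂ := (aestronglyMeasurable_poisson_dilate hgi.aestronglyMeasurable r).sub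
    hgi.aestronglyMeasurable
  have hm₃ := (hhi.sub hgi).aestronglyMeasurable
  rw [hsplit]
  calc _ ≤ eLpNorm ((fun s : Circle => poisson (fun x => h x - g x) (r * s)) +
          fun s : Circle => poisson g (r * s) - g s) q arcMeasure +
          eLpNorm (h - ⇑g) q arcMeasure := eLpNorm_sub_le (hm₁.add hm₂) hm₃ hq
    _ ≤ (ε / 3 + ε / 3) + ε / 3 := by
        gcongr
        exact (eLpNorm_add_le hm₁ hm₂ hq).trans
          (add_le_add ((eLpNorm_poisson_dilate_le hr hq hq' hm₃).trans hg) hrg)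
    _ = ε := ENNReal.add_thirds ε

theorem exists_seq_tendsto_ae_poisson (hh : Integrable h arcMeasure) :
    ∃ ρ : ℕ → ℝ, Tendsto ρ atTop (𝓝[<] 1) ∧
      ∀ᵐ s : Circle ∂arcMeasure, Tendsto (fun k => poisson h (ρ k * s)) atTop (𝓝 (h s)) :=
  (tendstoInMeasure_of_tendsto_eLpNorm one_ne_zero
    (fun r : ℝ => aestronglyMeasurable_poisson_dilate hh.aestronglyMeasurable r)
    hh.aestronglyMeasurable (tendsto_eLpNorm_poisson_dilate_sub le_rfl ENNReal.one_ne_top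
      (memLp_one_iff_integrable.2 hh))).exists_seq_tendsto_ae'

end Dilates

theorem tendsto_poisson_of_tendsto_eLpNorm {ι E : Type*} [NormedAddCommGroup E] [NormedSpace ℝ E]
    {l : Filter ι} {t : ℂ} (ht : t ∈ ball (0 : ℂ) 1) {a : ι → Circle → E} {h : Circle → E}
    (ha : ∀ᶠ i in l, Integrable (a i) arcMeasure) (hh : Integrable h arcMeasure)
    (hlim : Tendsto (fun i => eLpNorm (fun s => a i s - h s) 1 arcMeasure) l (𝓝 0)) :
    Tendsto (fun i => poisson (a i) t) l (𝓝 (poisson h t)) := by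
  have hlim' := ENNReal.Tendsto.const_mul (a := ENNReal.ofReal ((1 + ‖t‖) / (1 - ‖t‖))) hlim
    (Or.inr ENNReal.ofReal_ne_top)
  rw [mul_zero] at hlim'
  rw [tendsto_iff_edist_tendsto_0]
  refine tendsto_of_tendsto_of_tendsto_of_le_of_le' tendsto_const_nhds hlim'
    (.of_forall fun _ => zero_le) (ha.mono fun i hi => ?_)
  rw [edist_eq_enorm_sub, ← poisson_sub ht hi hh, eLpNorm_one_eq_lintegral_enorm,
    ← lintegral_const_mul' _ _ ENNReal.ofReal_ne_top]
  refine (enorm_integral_le_lintegral_enorm _).trans (lintegral_mono fun s => ?_)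
  change ‖kernel t s • _‖ₑ ≤ _
  rw [enorm_smul, Real.enorm_of_nonneg (kernel_pos ht s).le]
  gcongr
  exact kernel_le ht s

section Analytic

variable {E : Type*} [NormedAddCommGroup E] [NormedSpace ℂ E] {h : Circle → E} {t : ℂ}

theorem continuous_herglotz (ht : t ∈ ball (0 : ℂ) 1) :
    Continuous fun s : Circle => herglotzRieszKernel 0 t s := by
  simp only [herglotzRieszKernel_def, sub_zero]
  exact (by fun_prop : Continuous fun s : Circle => (s : ℂ) + t).div (by fun_prop)
    (sub_ne_zero_of_mem_ball ht)

theorem analyticOnNhd_integral_herglotz [CompleteSpace E] (hh : Integrable h arcMeasure) :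
    AnalyticOnNhd ℂ (fun t => ∫ s : Circle, herglotzRieszKernel 0 t s • h s ∂arcMeasure)
      (ball 0 1) := by
  let g : ℂ → E := fun z => h (Circle.exp z.arg)
  have hg (s : Circle) : g s = h s := by simp only [g, Circle.exp_arg]
  refine (analyticOnNhd_circleAverage_herglotzRieszKernel_smul
    (circleIntegrable_of_integrable_arcMeasure hh hg)).congr isOpen_ball fun t ht => ?_
  exact (integral_arcMeasure (integrable_continuous_smul (continuous_herglotz ht)
    hh).aestronglyMeasurable fun s => by rw [hg]).symm

theorem harmonicOnNhd_poisson {h : Circle → ℝ} (hh : Integrable h arcMeasure) :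
    InnerProductSpace.HarmonicOnNhd (poisson h) (ball 0 1) := by
  have hc : Integrable (fun s => (h s : ℂ)) arcMeasure := hh.ofReal
  intro t ht
  refine (InnerProductSpace.harmonicAt_congr_nhds ?_).1
    (analyticOnNhd_integral_herglotz hc t ht).harmonicAt_re
  filter_upwards [isOpen_ball.mem_nhds ht] with x hx
  rw [← RCLike.re_eq_complex_re,
    ← integral_re (integrable_continuous_smul (continuous_herglotz hx) hc), poisson_def]
  refine integral_congr_ae (ae_of_all _ fun s => ?_)
  simp [kernel_eq_re_herglotz]

theorem ofReal_kernel (ht : t ∈ ball (0 : ℂ) 1) (s : Circle) : (kernel t s : ℂ) =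
    s * (1 - starRingEnd ℂ t * t) / ((s - t) * (1 - starRingEnd ℂ t * s)) := by
  have hden := one_sub_conj_mul_ne_zero ht (Circle.norm_coe s).le
  have hsub := sub_ne_zero_of_mem_ball ht s
  have hnorm : (‖(s : ℂ) - t‖ : ℂ) ^ 2 = (s - t) * (1 - starRingEnd ℂ t * s) / s := by
    rw [← Complex.mul_conj', map_sub, ← Circle.coe_inv_eq_conj, Circle.coe_inv]
    field_simp [s.coe_ne_zero]
  rw [kernel]
  push_cast
  rw [hnorm, ← Complex.conj_mul']
  field_simp [s.coe_ne_zero]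

theorem ofReal_kernel_eq_add (ht : t ∈ ball (0 : ℂ) 1) (s : Circle) : (kernel t s : ℂ) =
    (1 / 2 : ℂ) * (herglotzRieszKernel 0 t s + 1) +
      starRingEnd ℂ t * s / (1 - starRingEnd ℂ t * s) := by
  have hden := one_sub_conj_mul_ne_zero ht (Circle.norm_coe s).le
  have hsub := sub_ne_zero_of_mem_ball ht s
  rw [mul_comm] at hden
  rw [ofReal_kernel ht, herglotzRieszKernel_def, sub_zero, sub_zero]
  field_simp
  ring

theorem diffContOnCl_div_one_sub_conj_mul (ht : t ∈ ball (0 : ℂ) 1) {P : ℂ → ℂ}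
    (hP : Differentiable ℂ P) :
    DiffContOnCl ℂ (fun z => P z / (1 - starRingEnd ℂ t * z)) (ball 0 1) := by
  refine DifferentiableOn.diffContOnCl ?_
  rw [closure_ball _ one_ne_zero]
  exact hP.differentiableOn.fun_div (by fun_prop) fun z hz =>
    one_sub_conj_mul_ne_zero ht (mem_closedBall_zero_iff.1 hz)

/- On the circle the conjugate Cauchy kernel is `kernel t₀` times a function of the disc algebra
vanishing at `t₀`, namely the function `G` of the proof. -/
theorem integral_conj_cauchy_smul_eq_zero {t₀ : ℂ} (ht₀ : t₀ ∈ ball (0 : ℂ) 1)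
    (hann : ∀ G : ℂ → ℂ, DiffContOnCl ℂ G (ball 0 1) → G t₀ = 0 →
      poisson (fun s => G s • h s) t₀ = 0) (ht : t ∈ ball (0 : ℂ) 1) :
    ∫ s : Circle, (starRingEnd ℂ t * s / (1 - starRingEnd ℂ t * s)) • h s ∂arcMeasure = 0 := by
  let G : ℂ → ℂ := fun z => (z - t₀) * (1 - starRingEnd ℂ t₀ * z) *
    (1 - starRingEnd ℂ t₀ * t₀)⁻¹ * starRingEnd ℂ t / (1 - starRingEnd ℂ t * z)
  rw [← hann G (diffContOnCl_div_one_sub_conj_mul ht (by fun_prop)) (by simp [G]), poisson_def]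
  refine integral_congr_ae (ae_of_all _ fun s => ?_)
  have hsub := sub_ne_zero_of_mem_ball ht₀ s
  have hden₀ := one_sub_conj_mul_ne_zero ht₀ (Circle.norm_coe s).le
  have hden := one_sub_conj_mul_ne_zero ht (Circle.norm_coe s).le
  have hself := one_sub_conj_mul_ne_zero ht₀ (norm_lt_one_of_mem_ball ht₀).le
  rw [mul_comm] at hden₀ hden
  simp only [G]
  rw [← Complex.coe_smul, smul_smul, ofReal_kernel ht₀]
  congr 1
  field_simp

theorem differentiableOn_poisson_of_annihilates [CompleteSpace E] {t₀ : ℂ}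
    (ht₀ : t₀ ∈ ball (0 : ℂ) 1) (hh : Integrable h arcMeasure)
    (hann : ∀ G : ℂ → ℂ, DiffContOnCl ℂ G (ball 0 1) → G t₀ = 0 →
      poisson (fun s => G s • h s) t₀ = 0) :
    DifferentiableOn ℂ (poisson h) (ball 0 1) := by
  have hpoisson : ∀ t ∈ ball (0 : ℂ) 1, poisson h t =
      (1 / 2 : ℂ) • ((∫ s : Circle, herglotzRieszKernel 0 t s • h s ∂arcMeasure) +
        ∫ s, h s ∂arcMeasure) := by
    intro t ht
    have hherglotz := integrable_continuous_smul (continuous_herglotz ht) hh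
    have hsum : Integrable (fun s : Circle =>
        (1 / 2 : ℂ) • (herglotzRieszKernel 0 t s • h s + h s)) arcMeasure :=
      (hherglotz.add hh).smul _
    have hcauchy : Integrable (fun s : Circle =>
        (starRingEnd ℂ t * s / (1 - starRingEnd ℂ t * s)) • h s) arcMeasure :=
      integrable_continuous_smul (continuous_comp_coe_circle
        (diffContOnCl_div_one_sub_conj_mul ht (P := fun z => starRingEnd ℂ t * z) (by fun_prop))) hh
    have hkernel (s : Circle) : kernel t s • h s =
        (1 / 2 : ℂ) • (herglotzRieszKernel 0 t s • h s + h s) +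
          (starRingEnd ℂ t * s / (1 - starRingEnd ℂ t * s)) • h s := by
      rw [← Complex.coe_smul, ofReal_kernel_eq_add ht]
      module
    simp only [poisson_def, hkernel]
    rw [integral_add hsum hcauchy,
      integral_conj_cauchy_smul_eq_zero ht₀ hann ht, add_zero, integral_smul,
      integral_add hherglotz hh]
  refine DifferentiableOn.congr ?_ hpoisson
  exact ((analyticOnNhd_integral_herglotz hh).differentiableOn.add_const _).const_smul _

end Analytic

/-- Coordinatewise complex conjugation on `ℂⁿ`; it turns the bilinear pairing `bil` into the inner
product. -/
noncomputable def conjVec {n : ℕ} (z : EuclideanSpace ℂ (Fin n)) : EuclideanSpace ℂ (Fin n) :=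
  WithLp.toLp 2 fun j => starRingEnd ℂ (z j)

section Bil

variable {n : ℕ}

@[simp] theorem conjVec_apply (z : EuclideanSpace ℂ (Fin n)) (j : Fin n) :
    conjVec z j = starRingEnd ℂ (z j) := rfl

@[simp] theorem conjVec_conjVec (z : EuclideanSpace ℂ (Fin n)) : conjVec (conjVec z) = z := by
  ext j
  simp

theorem norm_conjVec (z : EuclideanSpace ℂ (Fin n)) : ‖conjVec z‖ = ‖z‖ := by
  simp [EuclideanSpace.norm_eq]

theorem continuous_conjVec : Continuous (conjVec : EuclideanSpace ℂ (Fin n) → _) := by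
  unfold conjVec
  fun_prop

theorem bil_eq_inner (z w : EuclideanSpace ℂ (Fin n)) : bil z w = inner ℂ (conjVec z) w := by
  simp [bil, PiLp.inner_apply, mul_comm]

theorem re_bil (z w : EuclideanSpace ℂ (Fin n)) : (bil z w).re = inner ℝ (conjVec z) w := by
  rw [bil_eq_inner]
  simp [PiLp.inner_apply, Complex.inner]

theorem norm_bil_le (z w : EuclideanSpace ℂ (Fin n)) : ‖bil z w‖ ≤ ‖z‖ * ‖w‖ := by
  rw [bil_eq_inner, ← norm_conjVec z]
  exact norm_inner_le_norm _ _

theorem bil_comm (z w : EuclideanSpace ℂ (Fin n)) : bil z w = bil w z := by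
  simp [bil, mul_comm]

theorem bil_sub_left (z z' w : EuclideanSpace ℂ (Fin n)) :
    bil (z - z') w = bil z w - bil z' w := by
  simp [bil, sub_mul, Finset.sum_sub_distrib]

theorem bil_smul_left (c : ℂ) (z w : EuclideanSpace ℂ (Fin n)) :
    bil (c • z) w = c * bil z w := by
  simp [bil, Finset.mul_sum, mul_assoc]

theorem continuous_bil :
    Continuous fun x : EuclideanSpace ℂ (Fin n) × EuclideanSpace ℂ (Fin n) => bil x.1 x.2 := by
  unfold bil
  fun_prop

theorem tendsto_bil {α : Type*} {l : Filter α} {a b : α → EuclideanSpace ℂ (Fin n)}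
    {z w : EuclideanSpace ℂ (Fin n)} (ha : Tendsto a l (𝓝 z)) (hb : Tendsto b l (𝓝 w)) :
    Tendsto (fun x => bil (a x) (b x)) l (𝓝 (bil z w)) :=
  Tendsto.comp (g := fun x : EuclideanSpace ℂ (Fin n) × EuclideanSpace ℂ (Fin n) => bil x.1 x.2)
    (f := fun x => (a x, b x)) (continuous_bil.tendsto (z, w)) (ha.prodMk_nhds hb)

theorem diffContOnCl_bil {f F : ℂ → EuclideanSpace ℂ (Fin n)} {s : Set ℂ}
    (hf : DiffContOnCl ℂ f s) (hF : DiffContOnCl ℂ F s) :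
    DiffContOnCl ℂ (fun t => bil (f t) (F t)) s := by
  refine ⟨?_, fun t ht => tendsto_bil (hf.continuousOn t ht) (hF.continuousOn t ht)⟩
  unfold bil
  exact DifferentiableOn.fun_sum fun j _ =>
    (differentiableOn_euclidean.1 hf.differentiableOn j).fun_mul
      (differentiableOn_euclidean.1 hF.differentiableOn j)

section Measure

variable {S : Type*} [MeasurableSpace S] {μ : Measure S} {p q : ℝ≥0∞}
  {a b : S → EuclideanSpace ℂ (Fin n)}

theorem aestronglyMeasurable_bil (ha : AEStronglyMeasurable a μ)
    (hb : AEStronglyMeasurable b μ) : AEStronglyMeasurable (fun s => bil (a s) (b s)) μ :=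
  Continuous.comp_aestronglyMeasurable
    (g := fun x : EuclideanSpace ℂ (Fin n) × EuclideanSpace ℂ (Fin n) => bil x.1 x.2)
    (f := fun s => (a s, b s)) continuous_bil (ha.prodMk hb)

theorem eLpNorm_bil_le [q.HolderConjugate p] (ha : AEStronglyMeasurable a μ)
    (hb : AEStronglyMeasurable b μ) :
    eLpNorm (fun s => bil (a s) (b s)) 1 μ ≤ eLpNorm a q μ * eLpNorm b p μ := by
  have h := eLpNorm_le_eLpNorm_mul_eLpNorm_of_nnnorm (p := q) (q := p) (r := 1) ha hb bil 1
    (ae_of_all _ fun s => by rw [one_mul]; exact norm_bil_le _ _)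
  simpa using h

theorem integrable_bil [q.HolderConjugate p] (ha : MemLp a q μ) (hb : MemLp b p μ) :
    Integrable (fun s => bil (a s) (b s)) μ := by
  rw [← memLp_one_iff_integrable]
  exact ⟨aestronglyMeasurable_bil ha.1 hb.1,
    (eLpNorm_bil_le ha.1 hb.1).trans_lt (ENNReal.mul_lt_top ha.2 hb.2)⟩

end Measure

theorem tendsto_poisson_bil {ι : Type*} {l : Filter ι} {p q : ℝ≥0∞} [q.HolderConjugate p] {t : ℂ}
    (ht : t ∈ ball (0 : ℂ) 1) {a b : Circle → EuclideanSpace ℂ (Fin n)}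
    {A : ι → Circle → EuclideanSpace ℂ (Fin n)} (hA : ∀ᶠ i in l, MemLp (A i) q arcMeasure)
    (ha : MemLp a q arcMeasure) (hb : MemLp b p arcMeasure)
    (hlim : Tendsto (fun i => eLpNorm (A i - a) q arcMeasure) l (𝓝 0)) :
    Tendsto (fun i => poisson (fun s => bil (A i s) (b s)) t) l
      (𝓝 (poisson (fun s => bil (a s) (b s)) t)) := by
  refine tendsto_poisson_of_tendsto_eLpNorm ht (hA.mono fun i hi => integrable_bil hi hb)
    (integrable_bil ha hb) ?_
  have hmul := ENNReal.Tendsto.mul_const (b := eLpNorm b p arcMeasure) hlim (Or.inr hb.2.ne)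
  rw [zero_mul] at hmul
  refine tendsto_of_tendsto_of_tendsto_of_le_of_le' tendsto_const_nhds hmul
    (.of_forall fun _ => zero_le) (hA.mono fun i hi => ?_)
  have h := eLpNorm_bil_le (q := q) (p := p) (hi.sub ha).1 hb.1
  simpa only [Pi.sub_apply, bil_sub_left] using h

end Bil

section Hardy

variable {n : ℕ} {p q : ℝ≥0∞} {f F g : ℂ → EuclideanSpace ℂ (Fin n)}
  {fb Fb : Circle → EuclideanSpace ℂ (Fin n)} {t : ℂ}

theorem IsHardy.diffContOnCl_dilate (hf : IsHardy q f fb) {r : ℝ} (hr : r ∈ Ioo (0 : ℝ) 1) :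
    DiffContOnCl ℂ (fun t => f (r * t)) (ball 0 1) := by
  refine DifferentiableOn.diffContOnCl ?_
  rw [closure_ball _ one_ne_zero]
  refine hf.holomorphic.comp (t := ball 0 1) (by fun_prop) fun z hz => ?_
  rw [mem_closedBall_zero_iff] at hz
  rw [mem_ball_zero_iff, norm_mul, Complex.norm_real, Real.norm_of_nonneg hr.1.le]
  nlinarith [hr.1, hr.2, norm_nonneg z]

theorem IsHardy.eventually_memLp_dilate (hf : IsHardy q f fb) (r : ℝ≥0∞) :
    ∀ᶠ ρ : ℝ in 𝓝[<] 1, MemLp (fun s : Circle => f (ρ * s)) r arcMeasure := by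
  filter_upwards [Ioo_mem_nhdsLT zero_lt_one] with ρ hρ
  exact memLp_of_continuous (continuous_comp_coe_circle (hf.diffContOnCl_dilate hρ)) r

theorem IsHardy.tendsto_eLpNorm_dilate (hf : IsHardy q f fb) {r : ℝ≥0∞} (hr : 1 ≤ r)
    (hr' : r ≠ ∞) (hrq : r ≤ q) :
    Tendsto (fun ρ : ℝ => eLpNorm ((fun s : Circle => f (ρ * s)) - fb) r arcMeasure)
      (𝓝[<] 1) (𝓝 0) := by
  refine (tendsto_eLpNorm_poisson_dilate_sub hr hr' (hf.memLp.mono_exponent hrq)).congr' ?_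
  filter_upwards [Ioo_mem_nhdsLT zero_lt_one] with ρ hρ
  congr 2
  ext1 s
  exact (hf.eq_poisson _ (ofReal_mul_circle_mem_ball hρ s)).symm

theorem IsHardy.tendsto_dilate (hf : IsHardy q f fb) (ht : t ∈ ball (0 : ℂ) 1) :
    Tendsto (fun ρ : ℝ => f (ρ * t)) (𝓝[<] 1) (𝓝 (f t)) := by
  have hcont := (hf.holomorphic.differentiableAt (isOpen_ball.mem_nhds ht)).continuousAt
  refine hcont.tendsto.comp ?_
  have hmul : Continuous fun ρ : ℝ => (ρ : ℂ) * t := by fun_prop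
  simpa using (hmul.tendsto 1).mono_left nhdsWithin_le_nhds

theorem IsHardy.poisson_bil_of_diffContOnCl (hF : IsHardy p F Fb) (hp : 1 ≤ p)
    (hg : DiffContOnCl ℂ g (ball 0 1)) (ht : t ∈ ball (0 : ℂ) 1) :
    poisson (fun s => bil (Fb s) (g s)) t = bil (F t) (g t) := by
  have hboundary : Tendsto (fun ρ : ℝ => poisson (fun s => bil (F (ρ * s)) (g s)) t) (𝓝[<] 1)
      (𝓝 (poisson (fun s => bil (Fb s) (g s)) t)) :=
    tendsto_poisson_bil (q := 1) (p := ∞) ht (hF.eventually_memLp_dilate 1)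
      (hF.memLp.mono_exponent hp) (memLp_of_continuous (continuous_comp_coe_circle hg) ∞)
      (hF.tendsto_eLpNorm_dilate le_rfl ENNReal.one_ne_top hp)
  refine tendsto_nhds_unique hboundary
    ((tendsto_bil (hF.tendsto_dilate ht) tendsto_const_nhds).congr' ?_)
  filter_upwards [Ioo_mem_nhdsLT zero_lt_one] with ρ hρ
  exact (poisson_of_diffContOnCl (diffContOnCl_bil (hF.diffContOnCl_dilate hρ) hg) ht).symm

theorem IsHardy.poisson_bil [q.HolderConjugate p] (hf : IsHardy q f fb) (hF : IsHardy p F Fb)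
    (hq : q ≠ ∞) (ht : t ∈ ball (0 : ℂ) 1) :
    poisson (fun s => bil (fb s) (Fb s)) t = bil (f t) (F t) := by
  have hboundary : Tendsto (fun ρ : ℝ => poisson (fun s => bil (f (ρ * s)) (Fb s)) t) (𝓝[<] 1)
      (𝓝 (poisson (fun s => bil (fb s) (Fb s)) t)) :=
    tendsto_poisson_bil (q := q) (p := p) ht (hf.eventually_memLp_dilate q) hf.memLp hF.memLp
      (hf.tendsto_eLpNorm_dilate (ENNReal.HolderConjugate.one_le q p) hq le_rfl)
  refine tendsto_nhds_unique hboundary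
    ((tendsto_bil (hf.tendsto_dilate ht) tendsto_const_nhds).congr' ?_)
  filter_upwards [Ioo_mem_nhdsLT zero_lt_one] with ρ hρ
  simpa only [bil_comm (F t), bil_comm (Fb _)] using
    (hF.poisson_bil_of_diffContOnCl (ENNReal.HolderConjugate.one_le p q)
      (hf.diffContOnCl_dilate hρ) ht).symm

end Hardy

theorem exists_continuous_minorant {X : Type*} [PseudoMetricSpace X] {g : X → EReal} {x : X}
    (hg : LowerSemicontinuousAt g x) {a A : ℝ} (hA : ∀ y, (A : EReal) ≤ g y)
    (ha : (a : EReal) < g x) :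
    ∃ m : X → ℝ, Continuous m ∧ m x = a ∧ ∀ y, (m y : EReal) ≤ g y := by
  obtain ⟨δ, hδ, hball⟩ := Metric.eventually_nhds_iff.1 (hg a ha)
  have hK : 0 ≤ (|a| + |A|) / δ := by positivity
  refine ⟨fun y => a - (|a| + |A|) / δ * dist y x, by fun_prop, by simp, fun y => ?_⟩
  rcases lt_or_ge (dist y x) δ with hd | hd
  · refine le_trans (EReal.coe_le_coe_iff.2 ?_) (hball hd).le
    exact sub_le_self a (mul_nonneg hK dist_nonneg)
  · have hfar : |a| + |A| ≤ (|a| + |A|) / δ * dist y x := by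
      calc |a| + |A| = (|a| + |A|) / δ * δ := by field_simp
        _ ≤ _ := by gcongr
    refine le_trans (EReal.coe_le_coe_iff.2 ?_) (hA y)
    linarith [le_abs_self a, neg_abs_le A]

theorem integrable_toReal_of_ae_le {S : Type*} [MeasurableSpace S] {μ : Measure S}
    [IsFiniteMeasure μ] {u : S → EReal} (hu : Measurable u) {a : ℝ} (ha : ∀ s, (a : EReal) ≤ u s)
    {U : S → ℝ} (hU : Integrable U μ) (huU : ∀ᵐ s ∂μ, u s ≤ U s) :
    Integrable (fun s => (u s).toReal) μ := by
  refine integrable_of_le_of_le hu.ereal_toReal.aestronglyMeasurable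
    (g₁ := fun _ => a) (g₂ := U) ?_ ?_ (integrable_const a) hU
  · filter_upwards [huU] with s hs
    exact EReal.toReal_le_toReal (ha s) (EReal.coe_ne_bot a)
      (hs.trans_lt (EReal.coe_lt_top _)).ne
  · filter_upwards [huU] with s hs
    exact EReal.toReal_le_toReal hs ((EReal.bot_lt_coe a).trans_le (ha s)).ne'
      (EReal.coe_ne_top _)

theorem eventually_le_poisson_of_lowerSemicontinuousAt {g : Circle → EReal} {s : Circle}
    (hg : LowerSemicontinuousAt g s) (hgi : Integrable (fun x => (g x).toReal) arcMeasure)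
    (hgt : ∀ᵐ x ∂arcMeasure, g x < ⊤) {a A : ℝ} (hA : ∀ x, (A : EReal) ≤ g x)
    (ha : (a : EReal) < g s) :
    ∀ᶠ r : ℝ in 𝓝[<] 1, a ≤ poisson (fun x => (g x).toReal) (r * s) := by
  obtain ⟨b, hab, hb⟩ := EReal.lt_iff_exists_real_btwn.1 ha
  obtain ⟨m, hm, rfl, hmg⟩ := exists_continuous_minorant hg hA hb
  filter_upwards [Ioo_mem_nhdsLT zero_lt_one,
    ((tendstoUniformly_poisson_dilate hm).tendsto_at s).eventually_const_lt
      (EReal.coe_lt_coe_iff.1 hab)] with r hr har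
  refine har.le.trans (poisson_mono_ae (ofReal_mul_circle_mem_ball hr s)
    (integrable_of_continuous hm) hgi (hgt.mono fun x hx => ?_))
  exact EReal.toReal_le_toReal (hmg x) (EReal.coe_ne_bot _) hx.ne

section Boundary

variable {n : ℕ} {p q : ℝ≥0∞} {φ : Circle → EuclideanSpace ℂ (Fin n) → EReal}
  {f₀ : Circle → ℂ} {f F G : ℂ → EuclideanSpace ℂ (Fin n)}
  {fb Fb : Circle → EuclideanSpace ℂ (Fin n)} {t : ℂ}

theorem nhdsWithin_Ioo_prod_univ {X : Type*} [TopologicalSpace X] (z : X) :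
    𝓝[Ioo (0 : ℝ) 1 ×ˢ univ] ((1 : ℝ), z) = 𝓝[<] 1 ×ˢ 𝓝 z := by
  rw [nhdsWithin_prod_eq, nhdsWithin_univ, nhdsWithin_Ioo_eq_nhdsLT zero_lt_one]

theorem BoundaryLE.ae_le (hle : BoundaryLE (fiberLinear f₀ f) φ) (hf₀ : Integrable f₀ arcMeasure)
    (hq : 1 ≤ q) (hf : IsHardy q f fb) :
    ∀ᵐ s ∂arcMeasure, ∀ z, (((bil (fb s) z).re - (f₀ s).re : ℝ) : EReal) ≤ φ s z := by
  have hpair : Integrable (fun s => (fb s, (f₀ s).re)) arcMeasure :=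
    (hf.memLp.integrable hq).prodMk hf₀.re
  obtain ⟨ρ, hρ, hlim⟩ := exists_seq_tendsto_ae_poisson hpair
  filter_upwards [hle, hlim] with s hs hlim z
  have hfiber : Tendsto (fun k => fiberLinear f₀ f (ρ k * s) z) atTop
      (𝓝 ((bil (fb s) z).re - (f₀ s).re)) := by
    refine (((Complex.continuous_re.tendsto _).comp
      (tendsto_bil hlim.fst_nhds tendsto_const_nhds)).sub hlim.snd_nhds).congr' ?_
    filter_upwards [hρ.eventually (Ioo_mem_nhdsLT zero_lt_one)] with k hk
    have ht := ofReal_mul_circle_mem_ball hk s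
    have hfst := map_poisson (ContinuousLinearMap.fst ℝ _ _) ht hpair
    have hsnd := map_poisson (ContinuousLinearMap.snd ℝ _ _) ht hpair
    simp only [ContinuousLinearMap.coe_fst', ContinuousLinearMap.coe_snd'] at hfst hsnd
    rw [fiberLinear, hf.eq_poisson _ ht, ← hfst, ← hsnd]
    rfl
  have hradial : Tendsto (fun k => (ρ k, z)) atTop
      (𝓝[Ioo (0 : ℝ) 1 ×ˢ univ] ((1 : ℝ), z)) := by
    rw [nhdsWithin_Ioo_prod_univ]
    exact hρ.prodMk tendsto_const_nhds
  rw [← (EReal.tendsto_coe.2 hfiber).limsup_eq]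
  exact (limsup_le_limsup_of_le (u := fun x : ℝ × EuclideanSpace ℂ (Fin n) =>
    ((fiberLinear f₀ f ((x.1 : ℂ) * (s : ℂ)) x.2 : ℝ) : EReal)) hradial).trans (hs z)

theorem limsup_fiberLinear_le {s : Circle} {ζ : EuclideanSpace ℂ (Fin n)} {a : ℝ}
    (hf : Tendsto (fun r : ℝ => f (r * s)) (𝓝[<] 1) (𝓝 ζ))
    (hf₀ : ∀ b < a, ∀ᶠ r : ℝ in 𝓝[<] 1, b ≤ poisson (fun x => (f₀ x).re) (r * s))
    (z : EuclideanSpace ℂ (Fin n)) :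
    limsup (fun x : ℝ × EuclideanSpace ℂ (Fin n) =>
      ((fiberLinear f₀ f ((x.1 : ℂ) * (s : ℂ)) x.2 : ℝ) : EReal))
      (𝓝[Ioo (0 : ℝ) 1 ×ˢ univ] ((1 : ℝ), z)) ≤ ((bil ζ z).re - a : ℝ) := by
  rw [nhdsWithin_Ioo_prod_univ]
  refine EReal.le_of_forall_lt_iff_le.1 fun b hb => limsup_le_of_le (by isBoundedDefault) ?_
  obtain ⟨c, hbil, hc⟩ : ∃ c, (bil ζ z).re < c ∧ c - b < a := by
    obtain ⟨c, h₁, h₂⟩ := exists_between (sub_lt_iff_lt_add.1 (EReal.coe_lt_coe_iff.1 hb))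
    exact ⟨c, h₁, by linarith⟩
  have hre : Tendsto (fun x : ℝ × EuclideanSpace ℂ (Fin n) => (bil (f (x.1 * s)) x.2).re)
      (𝓝[<] 1 ×ˢ 𝓝 z) (𝓝 (bil ζ z).re) :=
    (Complex.continuous_re.tendsto _).comp (tendsto_bil (hf.comp tendsto_fst) tendsto_snd)
  filter_upwards [hre.eventually_lt_const hbil, tendsto_fst.eventually (hf₀ _ hc)] with x hx hx₀
  rw [EReal.coe_le_coe_iff, fiberLinear]
  linarith

theorem tendsto_dilate_circle (hG : DiffContOnCl ℂ G (ball 0 1)) (s : Circle) :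
    Tendsto (fun r : ℝ => G (r * s)) (𝓝[<] 1) (𝓝 (G s)) := by
  have hs : (s : ℂ) ∈ closure (ball (0 : ℂ) 1) := by
    rw [closure_ball _ one_ne_zero]
    simp [Circle.norm_coe]
  have hmul : Tendsto (fun r : ℝ => (r : ℂ) * s) (𝓝[<] 1) (𝓝 s) := by
    simpa using ((by fun_prop : Continuous fun r : ℝ => (r : ℂ) * s).tendsto 1).mono_left
      nhdsWithin_le_nhds
  refine (hG.continuousOn s hs).tendsto.comp (tendsto_nhdsWithin_iff.2 ⟨hmul, ?_⟩)
  filter_upwards [Ioo_mem_nhdsLT zero_lt_one] with r hr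
  exact subset_closure (ofReal_mul_circle_mem_ball hr s)

theorem boundaryLE_of_lowerSemicontinuous (hG : DiffContOnCl ℂ G (ball 0 1)) {g : Circle → EReal}
    (hg : LowerSemicontinuous g) (hgi : Integrable (fun s => (g s).toReal) arcMeasure)
    (hgt : ∀ᵐ s ∂arcMeasure, g s < ⊤) {A : ℝ} (hA : ∀ s, (A : EReal) ≤ g s)
    (hgφ : ∀ᵐ s : Circle ∂arcMeasure, ∀ z,
      (((bil (G s) z).re - (g s).toReal : ℝ) : EReal) ≤ φ s z) :
    BoundaryLE (fiberLinear (fun s => ((g s).toReal : ℂ)) G) φ := by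
  filter_upwards [hgt, hgφ] with s hs hφ z
  refine (limsup_fiberLinear_le (tendsto_dilate_circle hG s) (fun b hb => ?_) z).trans (hφ z)
  simp only [Complex.ofReal_re]
  refine eventually_le_poisson_of_lowerSemicontinuousAt (hg s) hgi hgt hA ?_
  rwa [← EReal.coe_toReal hs.ne ((EReal.bot_lt_coe A).trans_le (hA s)).ne', EReal.coe_lt_coe_iff]

theorem isHardy_of_diffContOnCl (hG : DiffContOnCl ℂ G (ball 0 1)) (q : ℝ≥0∞) :
    IsHardy q G fun s => G s where
  holomorphic := hG.differentiableOn
  memLp := memLp_of_continuous (continuous_comp_coe_circle hG) q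
  eq_poisson _ ht := (poisson_of_diffContOnCl hG ht).symm

theorem fiberLinear_eq_poisson [q.HolderConjugate p] (hq : q ≠ ∞)
    (hf₀ : Integrable f₀ arcMeasure) (hf : IsHardy q f fb) (hF : IsHardy p F Fb)
    (ht : t ∈ ball (0 : ℂ) 1) :
    fiberLinear f₀ f t (F t) = poisson (fun s => (bil (fb s) (Fb s)).re - (f₀ s).re) t := by
  have hbil := integrable_bil (q := q) (p := p) hf.memLp hF.memLp
  have hre := map_poisson Complex.reCLM ht hbil
  rw [hf.poisson_bil hF hq ht] at hre
  simp only [Complex.reCLM_apply] at hre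
  rw [fiberLinear, hre]
  exact (poisson_sub (h := fun s => (bil (fb s) (Fb s)).re) ht hbil.re hf₀.re).symm

theorem exists_nonneg_fiberLinear_eq_poisson_sub [q.HolderConjugate p] (hq : q ≠ ∞)
    (hf₀ : Integrable f₀ arcMeasure) (hf : IsHardy q f fb) (hF : IsHardy p F Fb)
    (hle : BoundaryLE (fiberLinear f₀ f) φ) {H : Circle → ℝ} (hH : Integrable H arcMeasure)
    (hφH : ∀ᵐ s ∂arcMeasure, φ s (Fb s) ≤ H s) :
    ∃ v : Circle → ℝ, Integrable v arcMeasure ∧ (∀ᵐ s ∂arcMeasure, 0 ≤ v s) ∧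
      ∀ t ∈ ball (0 : ℂ) 1, fiberLinear f₀ f t (F t) = poisson H t - poisson v t := by
  have hpair : Integrable (fun s => (bil (fb s) (Fb s)).re - (f₀ s).re) arcMeasure :=
    (integrable_bil (q := q) (p := p) hf.memLp hF.memLp).re.sub hf₀.re
  refine ⟨fun s => H s - ((bil (fb s) (Fb s)).re - (f₀ s).re), hH.sub hpair, ?_, fun t ht => ?_⟩
  · filter_upwards [hle.ae_le hf₀ (ENNReal.HolderConjugate.one_le q p) hf, hφH] with s hs hsH
    exact sub_nonneg.2 (EReal.coe_le_coe_iff.1 ((hs (Fb s)).trans hsH))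
  · rw [poisson_sub ht hH hpair, ← fiberLinear_eq_poisson hq hf₀ hf hF ht, sub_sub_cancel]

end Boundary

section Hull

variable {n : ℕ} {p : ℝ≥0∞} {φ : Circle → EuclideanSpace ℂ (Fin n) → EReal}
  {F G : ℂ → EuclideanSpace ℂ (Fin n)} {Fb : Circle → EuclideanSpace ℂ (Fin n)} {t t₀ : ℂ}
  {w₀ : EuclideanSpace ℂ (Fin n)} {H : Circle → ℝ}

theorem conjExponent_ne_top (hp : 1 < p) : ENNReal.conjExponent p ≠ ∞ := by
  simp [ENNReal.conjExponent, tsub_eq_zero_iff_le, hp]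

theorem holderConjugate_conjExponent (hp : 1 < p) :
    (ENNReal.conjExponent p).HolderConjugate p :=
  (ENNReal.HolderConjugate.conjExponent hp.le).symm

theorem hull_le_poisson (hp : 1 < p) (hF : IsHardy p F Fb) (hH : Integrable H arcMeasure)
    (hφH : ∀ᵐ s ∂arcMeasure, φ s (Fb s) ≤ H s) (ht : t ∈ ball (0 : ℂ) 1) :
    hull p φ t (F t) ≤ (poisson H t : ℝ) := by
  have := holderConjugate_conjExponent hp
  refine sSup_le ?_
  rintro _ ⟨f₀, f, fb, hf₀, hf, hle, rfl⟩
  obtain ⟨v, -, hv₀, hv⟩ :=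
    exists_nonneg_fiberLinear_eq_poisson_sub (conjExponent_ne_top hp) hf₀ hf hF hle hH hφH
  rw [hv t ht, EReal.coe_le_coe_iff]
  exact sub_le_self _ (poisson_nonneg ht hv₀)

/- A competitor that nearly attains `poisson H` at `t₀` differs from it by a nonnegative Poisson
integral that is small at `t₀`, hence small at `t` by Harnack's inequality. -/
theorem poisson_le_hull (hp : 1 < p) (hF : IsHardy p F Fb) (hH : Integrable H arcMeasure)
    (hφH : ∀ᵐ s ∂arcMeasure, φ s (Fb s) ≤ H s) (ht₀ : t₀ ∈ ball (0 : ℂ) 1)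
    (h₀ : (poisson H t₀ : ℝ) ≤ hull p φ t₀ (F t₀)) (ht : t ∈ ball (0 : ℂ) 1) :
    (poisson H t : ℝ) ≤ hull p φ t (F t) := by
  have := holderConjugate_conjExponent hp
  refine EReal.ge_of_forall_gt_iff_ge.1 fun b hb => ?_
  let C := (1 + ‖t‖) / (1 - ‖t‖) / ((1 - ‖t₀‖) / (1 + ‖t₀‖))
  have hC : 0 ≤ C := by
    have htn := norm_lt_one_of_mem_ball ht
    have ht₀n := norm_lt_one_of_mem_ball ht₀
    exact div_nonneg (div_nonneg (by positivity) (by linarith))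
      (div_nonneg (by linarith) (by positivity))
  obtain ⟨ε, hε, hCε⟩ := exists_pos_mul_lt (sub_pos.2 (EReal.coe_lt_coe_iff.1 hb)) C
  have hnear : ((poisson H t₀ - ε : ℝ) : EReal) < hull p φ t₀ (F t₀) :=
    (EReal.coe_lt_coe_iff.2 (sub_lt_self _ hε)).trans_le h₀
  obtain ⟨_, ⟨f₀, f, fb, hf₀, hf, hle, rfl⟩, hfε⟩ := lt_sSup_iff.1 hnear
  obtain ⟨v, hvi, hv₀, hv⟩ :=
    exists_nonneg_fiberLinear_eq_poisson_sub (conjExponent_ne_top hp) hf₀ hf hF hle hH hφH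
  rw [hv t₀ ht₀, EReal.coe_lt_coe_iff, sub_lt_sub_iff_left] at hfε
  have hharnack : poisson v t ≤ C * poisson v t₀ := poisson_le_mul_poisson ht ht₀ hvi hv₀
  refine le_trans (EReal.coe_le_coe_iff.2 ?_) (le_sSup ⟨f₀, f, fb, hf₀, hf, hle, rfl⟩)
  rw [hv t ht]
  linarith [mul_le_mul_of_nonneg_left hfε.le hC]

theorem hull_eq_poisson (hp : 1 < p) (hF : IsHardy p F Fb) (hH : Integrable H arcMeasure)
    (hφH : ∀ᵐ s ∂arcMeasure, φ s (Fb s) ≤ H s) (ht₀ : t₀ ∈ ball (0 : ℂ) 1)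
    (h₀ : (poisson H t₀ : ℝ) ≤ hull p φ t₀ (F t₀)) (ht : t ∈ ball (0 : ℂ) 1) :
    hull p φ t (F t) = (poisson H t : ℝ) :=
  (hull_le_poisson hp hF hH hφH ht).antisymm (poisson_le_hull hp hF hH hφH ht₀ h₀ ht)

/- By Vitali–Carathéodory, `ψ` may be replaced by a lower semicontinuous majorant; the radial lower
limits of the Poisson integral of the latter dominate it at every point of the circle. -/
theorem re_bil_sub_integral_le_hull (ht₀ : t₀ ∈ ball (0 : ℂ) 1) {ψ : Circle → ℝ}
    (hψ : Integrable ψ (harmonicMeasure t₀)) {A : ℝ} (hA : ∀ s, A ≤ ψ s)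
    (hG : DiffContOnCl ℂ G (ball 0 1))
    (hψφ : ∀ (s : Circle) z, (((bil (G s) z).re - ψ s : ℝ) : EReal) ≤ φ s z) :
    (((bil (G t₀) w₀).re - ∫ s, ψ s ∂harmonicMeasure t₀ : ℝ) : EReal) ≤ hull p φ t₀ w₀ := by
  have := isProbabilityMeasure_harmonicMeasure ht₀
  refine EReal.ge_of_forall_gt_iff_ge.1 fun b hb => ?_
  obtain ⟨g, hψg, hg, hgi, hgt, hint⟩ := exists_lt_lowerSemicontinuous_integral_lt ψ hψ
    (sub_pos.2 (EReal.coe_lt_coe_iff.1 hb))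
  rw [integrable_harmonicMeasure_iff ht₀] at hgi
  rw [ae_harmonicMeasure_iff ht₀] at hgt
  rw [integral_harmonicMeasure ht₀] at hint
  have hle : BoundaryLE (fiberLinear (fun s => ((g s).toReal : ℂ)) G) φ := by
    refine boundaryLE_of_lowerSemicontinuous hG hg hgi hgt
      (fun s => (EReal.coe_le_coe_iff.2 (hA s)).trans (hψg s).le) ?_
    filter_upwards [hgt] with s hs z
    refine (EReal.coe_le_coe_iff.2 (sub_le_sub_left ?_ _)).trans (hψφ s z)
    exact EReal.toReal_le_toReal (hψg s).le (EReal.coe_ne_bot _) hs.ne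
  refine le_trans (EReal.coe_le_coe_iff.2 ?_)
    (le_sSup ⟨fun s => ((g s).toReal : ℂ), G, _, hgi.ofReal, isHardy_of_diffContOnCl hG _, hle,
      rfl⟩)
  simp only [fiberLinear, Complex.ofReal_re]
  linarith

end Hull

/-- The coordinatewise conjugates of the boundary values of the functions in the disc algebra. The
conjugation is there because elements of this space are paired with other functions by the inner
product instead of `bil`. -/
def discAlgebraConj (n : ℕ) :
    Submodule ℝ (boundedMeasurable Circle (EuclideanSpace ℂ (Fin n))) where
  carrier := {g | ∃ G : ℂ → EuclideanSpace ℂ (Fin n), DiffContOnCl ℂ G (ball 0 1) ∧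
    ∀ s : Circle, g.1 s = conjVec (G s)}
  zero_mem' := ⟨fun _ => 0, diffContOnCl_const, fun s => by ext j; simp⟩
  add_mem' := by
    rintro f g ⟨F, hF, hf⟩ ⟨G, hG, hg⟩
    refine ⟨F + G, hF.add hG, fun s => ?_⟩
    change f.1 s + g.1 s = _
    rw [hf, hg]
    ext j
    simp
  smul_mem' := by
    rintro c f ⟨F, hF, hf⟩
    refine ⟨fun z => (c : ℂ) • F z, hF.const_smul (c : ℂ), fun s => ?_⟩
    change c • f.1 s = _
    rw [hf]
    ext j
    simp

section Duality

variable {n : ℕ} {p : ℝ≥0∞} {φ : Circle → EuclideanSpace ℂ (Fin n) → EReal} {t₀ : ℂ}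
  {w₀ : EuclideanSpace ℂ (Fin n)} {δ B : ℝ} {N : ℝ → ℝ}

theorem exists_mem_discAlgebraConj {G : ℂ → EuclideanSpace ℂ (Fin n)}
    (hG : DiffContOnCl ℂ G (ball 0 1)) :
    ∃ g ∈ discAlgebraConj n, ∀ s : Circle, g.1 s = conjVec (G s) := by
  have hc : Continuous fun s : Circle => conjVec (G s) :=
    continuous_conjVec.comp (continuous_comp_coe_circle hG)
  obtain ⟨C, hC⟩ := isCompact_univ.exists_bound_of_continuousOn hc.continuousOn
  exact ⟨⟨_, hc.measurable, C, fun s => hC s (mem_univ s)⟩, ⟨G, hG, fun _ => rfl⟩, fun _ => rfl⟩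

theorem integral_inner_conjVec_harmonicMeasure (ht₀ : t₀ ∈ ball (0 : ℂ) 1)
    {G : ℂ → EuclideanSpace ℂ (Fin n)} (hG : DiffContOnCl ℂ G (ball 0 1))
    (w₀ : EuclideanSpace ℂ (Fin n)) :
    ∫ s : Circle, inner ℝ (conjVec (G s)) w₀ ∂harmonicMeasure t₀ = (bil (G t₀) w₀).re := by
  have hbil : DiffContOnCl ℂ (fun z => bil (G z) w₀) (ball 0 1) :=
    diffContOnCl_bil hG diffContOnCl_const
  have hre := map_poisson Complex.reCLM ht₀
    (integrable_of_continuous (μ := arcMeasure) (continuous_comp_coe_circle hbil))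
  rw [poisson_of_diffContOnCl hbil ht₀] at hre
  simp only [Complex.reCLM_apply, re_bil] at hre
  rw [integral_harmonicMeasure ht₀, ← hre, re_bil]

theorem integral_inner_sub_integral_conjugate_le_hull (hφ : ∀ s, IsSuperlinear (φ s) δ B N)
    (hmeas : Measurable fun x : Circle × EuclideanSpace ℂ (Fin n) => φ x.1 x.2)
    (ht₀ : t₀ ∈ ball (0 : ℂ) 1) {g : boundedMeasurable Circle (EuclideanSpace ℂ (Fin n))}
    (hg : g ∈ discAlgebraConj n) :
    ((∫ s, inner ℝ (g.1 s) w₀ ∂harmonicMeasure t₀ -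
      ∫ s, conjugate (φ s) (g.1 s) ∂harmonicMeasure t₀ : ℝ) : EReal) ≤ hull p φ t₀ w₀ := by
  have := isProbabilityMeasure_harmonicMeasure ht₀
  have hψ := (isConvexIntegrand_conjugate hφ hmeas).integrable (μ := harmonicMeasure t₀) g
  obtain ⟨G, hG, hgG⟩ := hg
  simp only [hgG] at hψ ⊢
  rw [integral_inner_conjVec_harmonicMeasure ht₀ hG]
  refine re_bil_sub_integral_le_hull ht₀ hψ (fun s => (hφ s).neg_le_conjugate _) hG fun s z => ?_
  refine EReal.le_of_forall_lt_iff_le.1 fun c hc => EReal.coe_le_coe_iff.2 ?_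
  have hfenchel := (hφ s).inner_sub_le_conjugate (conjVec (G s)) (p := (z, c)) hc.le
  rw [re_bil]
  linarith

theorem exists_density_of_hull_lt_top (hφ : ∀ s, IsSuperlinear (φ s) δ B N)
    (hmeas : Measurable fun x : Circle × EuclideanSpace ℂ (Fin n) => φ x.1 x.2)
    (ht₀ : t₀ ∈ ball (0 : ℂ) 1) (hfin : hull p φ t₀ w₀ < ⊤) :
    ∃ F : Circle → EuclideanSpace ℂ (Fin n), Measurable F ∧
      (∀ g ∈ discAlgebraConj n, ∫ s, inner ℝ (g.1 s) w₀ ∂harmonicMeasure t₀ =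
        ∫ s, inner ℝ (g.1 s) (F s) ∂harmonicMeasure t₀) ∧
      ∃ U : Circle → ℝ, Integrable U arcMeasure ∧ (poisson U t₀ : ℝ) ≤ hull p φ t₀ w₀ ∧
        ∀ᵐ s ∂arcMeasure, φ s (F s) ≤ U s := by
  have := isProbabilityMeasure_harmonicMeasure ht₀
  have hlow (g) (hg : g ∈ discAlgebraConj n) :=
    integral_inner_sub_integral_conjugate_le_hull (p := p) (w₀ := w₀) hφ hmeas ht₀ hg
  have hbot : hull p φ t₀ w₀ ≠ ⊥ :=
    ((EReal.bot_lt_coe _).trans_le (hlow 0 (zero_mem _))).ne'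
  lift hull p φ t₀ w₀ to ℝ using ⟨hfin.ne, hbot⟩ with m
  obtain ⟨F, hFm, -, hF, U, hU, hUm, hFU⟩ := (isConvexIntegrand_conjugate hφ hmeas).exists_dual
    (discAlgebraConj n) (integralInner (integrable_const w₀))
    (fun g hg => sub_le_iff_le_add'.1 (EReal.coe_le_coe_iff.1 (hlow g hg)))
    (TopologicalSpace.denseSeq _)
  rw [integrable_harmonicMeasure_iff ht₀] at hU
  rw [ae_harmonicMeasure_iff ht₀] at hFU
  rw [integral_harmonicMeasure ht₀] at hUm
  exact ⟨F, hFm, hF, U, hU, EReal.coe_le_coe_iff.2 hUm, hFU.mono fun s hs =>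
    (hφ s).le_of_forall_denseRange_inner_sub_conjugate_le
      (TopologicalSpace.denseRange_denseSeq _) hs⟩

theorem bil_smul_left_eq_smul_right (c : ℂ) (z w : EuclideanSpace ℂ (Fin n)) :
    bil (c • z) w = bil z (c • w) := by
  rw [bil_smul_left, bil_comm z, bil_comm z, bil_smul_left]

theorem poisson_smul_of_forall_discAlgebraConj (ht₀ : t₀ ∈ ball (0 : ℂ) 1)
    {F : Circle → EuclideanSpace ℂ (Fin n)} (hF : Integrable F arcMeasure)
    (hFw₀ : ∀ g ∈ discAlgebraConj n, ∫ s, inner ℝ (g.1 s) w₀ ∂harmonicMeasure t₀ =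
      ∫ s, inner ℝ (g.1 s) (F s) ∂harmonicMeasure t₀) {G : ℂ → ℂ}
    (hG : DiffContOnCl ℂ G (ball 0 1)) : poisson (fun s => G s • F s) t₀ = G t₀ • w₀ := by
  have hGF : Integrable (fun s : Circle => G s • F s) (harmonicMeasure t₀) :=
    (integrable_harmonicMeasure_iff ht₀).2
      (integrable_continuous_smul (continuous_comp_coe_circle hG) hF)
  refine ext_inner_left ℝ fun e => ?_
  have hGe : DiffContOnCl ℂ (fun z => G z • conjVec e) (ball 0 1) := hG.smul_const _
  have hinner (z : ℂ) (v : EuclideanSpace ℂ (Fin n)) :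
      inner ℝ (conjVec (G z • conjVec e)) v = inner ℝ e (G z • v) := by
    rw [← re_bil, bil_smul_left_eq_smul_right, re_bil, conjVec_conjVec]
  obtain ⟨g, hg, hgG⟩ := exists_mem_discAlgebraConj hGe
  have heq := hFw₀ g hg
  simp only [hgG] at heq
  rw [integral_inner_conjVec_harmonicMeasure ht₀ hGe, re_bil, hinner] at heq
  simp only [hinner] at heq
  rw [heq, ← integral_harmonicMeasure ht₀, integral_inner hGF]

theorem isHardy_poisson_of_forall_discAlgebraConj (hp : 1 ≤ p) (ht₀ : t₀ ∈ ball (0 : ℂ) 1)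
    {F : Circle → EuclideanSpace ℂ (Fin n)} (hF : MemLp F p arcMeasure)
    (hFw₀ : ∀ g ∈ discAlgebraConj n, ∫ s, inner ℝ (g.1 s) w₀ ∂harmonicMeasure t₀ =
      ∫ s, inner ℝ (g.1 s) (F s) ∂harmonicMeasure t₀) :
    IsHardy p (poisson F) F ∧ poisson F t₀ = w₀ := by
  have hFi := hF.integrable hp
  have hrep {G : ℂ → ℂ} := poisson_smul_of_forall_discAlgebraConj (G := G) ht₀ hFi hFw₀
  refine ⟨⟨differentiableOn_poisson_of_annihilates ht₀ hFi fun G hG hG₀ => ?_, hF,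
    fun _ _ => rfl⟩, ?_⟩
  · rw [hrep hG, hG₀, zero_smul]
  · simpa using hrep (G := fun _ => 1) diffContOnCl_const

end Duality

theorem harmonicOnNhd_toReal_of_eq_poisson {u : ℂ → EReal} {H : Circle → ℝ}
    (hH : Integrable H arcMeasure) (hu : ∀ t ∈ ball (0 : ℂ) 1, u t = (poisson H t : ℝ)) :
    InnerProductSpace.HarmonicOnNhd (fun t => (u t).toReal) (ball (0 : ℂ) 1) := fun t ht => by
  refine (InnerProductSpace.harmonicAt_congr_nhds ?_).1 (harmonicOnNhd_poisson hH t ht)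
  filter_upwards [isOpen_ball.mem_nhds ht] with x hx
  rw [hu x hx, EReal.toReal_coe]

end DiscInterpolation

open DiscInterpolation in
theorem mainTheorem1 {n : ℕ} (p : ℝ≥0∞) (hp : 1 < p)
    (φ : Circle → EuclideanSpace ℂ (Fin n) → EReal)
    (hmeas : Measurable (fun x : Circle × EuclideanSpace ℂ (Fin n) => φ x.1 x.2))
    (hconv : ∀ s, DiscInterpolation.IsConvexFun (φ s))
    (hgrowth : DiscInterpolation.UniformGrowth p φ)
    (t₀ : ℂ) (ht₀ : t₀ ∈ ball (0 : ℂ) 1) (w₀ : EuclideanSpace ℂ (Fin n))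
    (hfin : DiscInterpolation.hull p φ t₀ w₀ < ⊤) :
    ∃ (F : ℂ → EuclideanSpace ℂ (Fin n)) (Fb : Circle → EuclideanSpace ℂ (Fin n)),
      DiscInterpolation.IsHardy p F Fb ∧ F t₀ = w₀ ∧
      (∀ᵐ s ∂DiscInterpolation.arcMeasure, φ s (Fb s) < ⊤) ∧
      Integrable (fun s => (φ s (Fb s)).toReal) DiscInterpolation.arcMeasure ∧
      (∀ t ∈ ball (0 : ℂ) 1, DiscInterpolation.hull p φ t (F t) =
        ((DiscInterpolation.poisson (fun s => (φ s (Fb s)).toReal) t : ℝ) : EReal)) ∧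
      InnerProductSpace.HarmonicOnNhd (fun t => (DiscInterpolation.hull p φ t (F t)).toReal)
        (ball (0 : ℂ) 1) := by
  obtain ⟨δ, B, N, hsup⟩ := hgrowth.exists_isSuperlinear hp hconv
  obtain ⟨F, hFm, hFw₀, U, hU, hUhull, hφU⟩ :=
    exists_density_of_hull_lt_top hsup hmeas ht₀ hfin
  obtain ⟨hF, hFt₀⟩ := isHardy_poisson_of_forall_discAlgebraConj hp.le ht₀
    (hgrowth.memLp (zero_lt_one.trans hp).ne' hFm.aestronglyMeasurable hU hφU) hFw₀
  have hφt : ∀ᵐ s ∂arcMeasure, φ s (F s) < ⊤ :=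
    hφU.mono fun s hs => hs.trans_lt (EReal.coe_lt_top _)
  have hbelow (s : Circle) : ((-N 0 : ℝ) : EReal) ≤ φ s (F s) := by
    simpa using (hsup s).ge 0 (F s)
  have hH : Integrable (fun s => (φ s (F s)).toReal) arcMeasure :=
    integrable_toReal_of_ae_le (hmeas.comp (measurable_id.prodMk hFm)) hbelow hU hφU
  have h₀ : (poisson (fun s => (φ s (F s)).toReal) t₀ : ℝ) ≤ hull p φ t₀ (poisson F t₀) := by
    rw [hFt₀]
    refine le_trans (EReal.coe_le_coe_iff.2 (poisson_mono_ae ht₀ hH hU ?_)) hUhull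
    exact hφU.mono fun s hs => EReal.toReal_le_toReal hs
      ((EReal.bot_lt_coe _).trans_le (hbelow s)).ne' (EReal.coe_ne_top _)
  have hhull (t : ℂ) (ht : t ∈ ball (0 : ℂ) 1) := hull_eq_poisson hp hF hH
    (hφt.mono fun s hs => EReal.le_coe_toReal hs.ne) ht₀ h₀ ht
  exact ⟨poisson F, F, hF, hFt₀, hφt, hH, hhull, harmonicOnNhd_toReal_of_eq_poisson hH hhull⟩
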